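/- Let $I=(-1,1)$, $\beta>0$, $y_d\in L_2(I)$, $f\in H^1(I)$ and $\psi\in H^2(I)$ with $\psi(1)\ge 0$. Elements of $H^1(I)$ and $H^2(I)$ are identified with their continuous representatives on $[-1,1]$. Put $J(y,u)=\frac12\big[\|y-y_d\|_{L_2(I)}^2+\beta\|u\|_{L_2(I)}^2\big]$ and let $V=\{v\in H^2(I): v(-1)=v'(1)=0\}$. Let $(\bar y,\bar u)$ be the minimizer of $J$ over the set of all $(y,u)\in V\times L_2(I)$ with $-y''=u+f$ and $y'\le\psi$ on $I$. For a partition $\mathcal T_h$ of $I$ with mesh size $h$ (the largest length of an element), let $V_h\subset V$ be the cubic Hermite finite element space, i.e. the space of the $v\in V$ that are polynomials of degree at most $3$ on each element, let $P_h$ be the nodal interpolation operator into the continuous piecewise affine functions on $\mathcal T_h$, and let $K_h=\{v\in V_h: P_hv'\le P_h\psi \text{ on } [-1,1]\}$. Let $\bar y_h$ be the minimizer of $v\mapsto\frac12\big[\|v-y_d\|_{L_2(I)}^2+\beta\|v''+f\|_{L_2(I)}^2\big]$ over $K_h$, and put $\bar u_h=-\bar y_h''-f$. Then $(\bar y,\bar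 u)$ and $\bar y_h$ (for every partition) exist and are unique, and for every $\kappa$ there is a constant $C>0$, which may depend on $\kappa$ and on $\beta,y_d,f,\psi$ but not on the partition, such that for every partition $\mathcal T_h$ that is quasi-uniform with constant $\kappa$ (i.e. $h\le\kappa\,|T|$ for each element $T$ of $\mathcal T_h$) $$|\bar y-\bar y_h|_{H^1(I)}+\|\bar u-\bar u_h\|_{L_2(I)}\le Ch \qquad\text{and}\qquad \|\bar y-\bar y_h\|_{H^2(I)}\le Ch .$$ -/

import Mathlib

open MeasureTheory Set
open scoped ContDiff

noncomputable section

namespace DerivOCP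

/-- The open interval `I = (-1,1)`. -/
abbrev I : Set ℝ := Ioo (-1) 1

/-- Its closure `[-1,1]`. -/
abbrev Ibar : Set ℝ := Icc (-1) 1

/-- Membership in `L_2(I)`. -/
def MemL2 (g : ℝ → ℝ) : Prop := MemLp g 2 (volume.restrict I)

/-- The norm of `L_2(I)`; only meaningful for members of `L_2(I)`. -/
def l2Norm (g : ℝ → ℝ) : ℝ := Real.sqrt (∫ x in I, g x ^ 2)

/-- `g` is a weak derivative of `v` on `I`, tested against smooth functions that have compact
support in `I`. Only used when `v` and `g` belong to `L_2(I)`. -/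
def HasWeakDeriv (v g : ℝ → ℝ) : Prop :=
  ∀ φ : ℝ → ℝ, ContDiff ℝ ∞ φ → HasCompactSupport φ → tsupport φ ⊆ I →
    ∫ x in I, v x * deriv φ x = -∫ x in I, g x * φ x

/-- Membership in the Sobolev space `H^1(I)`. -/
def MemH1 (v : ℝ → ℝ) : Prop :=
  MemL2 v ∧ ∃ g : ℝ → ℝ, MemL2 g ∧ HasWeakDeriv v g

/-- An element of the Sobolev space `H^2(I)` with its first two weak derivatives. As usual in one
dimension, the element and its first derivative are represented by the (unique) functions in their
almost-everywhere classes that are continuous on `[-1,1]`, so that values at points, the end points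
included, make sense; in particular both belong to `L_2(I)`. The values of the fields
off `[-1,1]` play no role. -/
structure H2 where
  /-- the function, continuous on `[-1,1]` -/
  val : ℝ → ℝ
  /-- the first weak derivative, continuous on `[-1,1]` -/
  d1 : ℝ → ℝ
  /-- the second weak derivative (determined almost everywhere) -/
  d2 : ℝ → ℝ
  val_cont : ContinuousOn val Ibar
  d1_cont : ContinuousOn d1 Ibar
  d2_mem : MemL2 d2
  weak1 : HasWeakDeriv val d1
  weak2 : HasWeakDeriv d1 d2

/-- `|v - w|_{H^1(I)}`. -/
def h1SemiDist (v w : H2) : ℝ := l2Norm (fun x => v.d1 x - w.d1 x)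

/-- `‖v - w‖_{H^2(I)}`. -/
def h2Dist (v w : H2) : ℝ :=
  Real.sqrt (l2Norm (fun x => v.val x - w.val x) ^ 2 + l2Norm (fun x => v.d1 x - w.d1 x) ^ 2
    + l2Norm (fun x => v.d2 x - w.d2 x) ^ 2)

/-- The space `V` of the `v ∈ H^2(I)` with the mixed boundary conditions `v(-1) = v'(1) = 0`. -/
def InV (v : H2) : Prop := v.val (-1) = 0 ∧ v.d1 1 = 0

/-- The cost `J(y,u) = ½ (‖y - y_d‖² + β ‖u‖²)`. -/
def J (β : ℝ) (yd y u : ℝ → ℝ) : ℝ :=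
  1 / 2 * (l2Norm (fun x => y x - yd x) ^ 2 + β * l2Norm u ^ 2)

/-- The admissible pairs: `u ∈ L_2(I)`, `-y'' = u + f` and `y' ≤ ψ` on `I`, and the mixed boundary
conditions. -/
structure Admissible (f : ℝ → ℝ) (ψ y : H2) (u : ℝ → ℝ) : Prop where
  control : MemL2 u
  state : ∀ᵐ x ∂volume.restrict I, -y.d2 x = u x + f x
  constraint : ∀ x ∈ I, y.d1 x ≤ ψ.val x
  boundary : InV y

/-- `(y,u)` solves the optimal control problem: it minimizes `J` over the admissible pairs. -/
def IsOptimal (β : ℝ) (yd f : ℝ → ℝ) (ψ y : H2) (u : ℝ → ℝ) : Prop :=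
  Admissible f ψ y u ∧
    ∀ (z : H2) (w : ℝ → ℝ), Admissible f ψ z w → J β yd y.val u ≤ J β yd z.val w

/-- A partition `-1 = x_0 < x_1 < ⋯ < x_n = 1` of `I`. -/
structure Mesh where
  /-- the number of elements -/
  n : ℕ
  /-- the grid points -/
  node : Fin (n + 1) → ℝ
  strictMono : StrictMono node
  first : node 0 = -1
  last : node (Fin.last n) = 1

namespace Mesh

/-- The left end point of the `i`-th element. -/
def left (T : Mesh) (i : Fin T.n) : ℝ := T.node i.castSucc

/-- The right end point of the `i`-th element. -/
def right (T : Mesh) (i : Fin T.n) : ℝ := T.node i.succ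

/-- The length of the `i`-th element. -/
def length (T : Mesh) (i : Fin T.n) : ℝ := T.right i - T.left i

/-- The mesh size `h`, the largest length of an element. -/
def h (T : Mesh) : ℝ := ⨆ i, T.length i

/-- Quasi-uniformity with constant `κ`. -/
def QuasiUniform (T : Mesh) (κ : ℝ) : Prop := ∀ i, T.h ≤ κ * T.length i

end Mesh

/-- The cubic Hermite finite element space `V_h ⊆ V`: the functions in `V` (which are continuously
differentiable on `[-1,1]`) that are polynomials of degree at most three on each element. -/
def InVh (T : Mesh) (v : H2) : Prop :=
  InV v ∧ ∀ i, ∃ P : Polynomial ℝ, P.degree ≤ 3 ∧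
    ∀ x ∈ Icc (T.left i) (T.right i), v.val x = P.eval x

/-- The restriction of the nodal `P_1` interpolant `P_h ζ` to the `i`-th element: the affine function
that agrees with `ζ` at both end points of the element. -/
def p1Interp (T : Mesh) (ζ : ℝ → ℝ) (i : Fin T.n) (x : ℝ) : ℝ :=
  (T.right i - x) / T.length i * ζ (T.left i) + (x - T.left i) / T.length i * ζ (T.right i)

/-- The discrete constraint set `K_h = {v ∈ V_h : P_h v' ≤ P_h ψ on [-1,1]}`; the last inequality is
stated element by element. -/
def InKh (T : Mesh) (ψ v : H2) : Prop :=
  InVh T v ∧ ∀ i, ∀ x ∈ Icc (T.left i) (T.right i), p1Interp T v.d1 i x ≤ p1Interp T ψ.val i x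

/-- The control `-v'' - f` that belongs to a state `v`. -/
def control (f : ℝ → ℝ) (v : H2) (x : ℝ) : ℝ := -v.d2 x - f x

/-- `v` solves the discrete problem: it minimizes `½ (‖v - y_d‖² + β ‖v'' + f‖²)` over `K_h`. -/
def IsDiscreteOptimal (T : Mesh) (β : ℝ) (yd f : ℝ → ℝ) (ψ v : H2) : Prop :=
  InKh T ψ v ∧ ∀ z : H2, InKh T ψ z → J β yd v.val (control f v) ≤ J β yd z.val (control f z)

end DerivOCP

end

/-! Because y(-1) = y'(1) = 0, a state is determined by g = y'', and the values of y and y' at a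
point are bounded linear functionals of g in L_2(I). The continuous and the discrete problem thus
minimize the same strictly convex quadratic `cost` over two closed convex subsets of L_2(I)
(`isOptimal_iff`, `isDiscreteOptimal_iff`). Both sets contain the point from `exists_feasible`, and
Hilbert space projection gives existence and uniqueness.

For the rate, the gradient at the optimum is G = βg + F with F absolutely continuous and F' in L_2
(`exists_gradient`). In terms of the gap c = ψ - y', the optimality condition is an obstacle problem
(`ObstacleVI`) with G = E - βc' and E = βψ' + F. Testing with hat functions shows that the primitive
of G is convex, and affine where c > 0. The regularity needed is contained in
`secant_bounds_of_contact`: on an interval with a contact point inside, all averages of G lie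
between the minimum and the maximum of E, so G oscillates by at most ∫|E'|, and βc is at most the
length times that oscillation. Without contact inside, G is constant. Hence g is approximated to
order h by its element means.

Let k be the function of element means of g. The slopes of k and g agree at the nodes, so k is
feasible for the discrete problem and ‖k - g‖ = O(h). The discrete variational inequality for the
minimizer gh is tested with k, and ∫ G (k - gh) has to be bounded from above. Replacing G by its
means costs O(h)‖k - gh‖. Summation by parts turns the rest into products of jumps of the means with
gaps at the nodes. Both factors are small near the contact set and a product vanishes away from it,
so the sum is O(h²) (`sum_avg_mul_le`). A quadratic inequality for ‖gh - g‖ remains. -/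

namespace DerivOCP

/-! ### Primitives on [-1,1] and weak derivatives -/

/-- `F` is a primitive of the integrable function `φ` on `[-1,1]`. -/
structure IsPrimitive (F φ : ℝ → ℝ) : Prop where
  integrable : IntervalIntegrable φ volume (-1) 1
  eq : ∀ x ∈ Ibar, F x = F (-1) + ∫ t in (-1)..x, φ t

theorem uIcc_subset_Ibar {a b : ℝ} (ha : a ∈ Ibar) (hb : b ∈ Ibar) : uIcc a b ⊆ Ibar :=
  uIcc_subset_Icc ha hb

theorem intervalIntegrable_mono {φ : ℝ → ℝ} (h : IntervalIntegrable φ volume (-1) 1)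
    {a b : ℝ} (ha : a ∈ Ibar) (hb : b ∈ Ibar) : IntervalIntegrable φ volume a b := by
  refine h.mono_set ?_
  rw [uIcc_of_le (by norm_num : (-1 : ℝ) ≤ 1)]
  exact uIcc_subset_Ibar ha hb

theorem neg_one_mem_Ibar : (-1 : ℝ) ∈ Ibar := by simp

theorem one_mem_Ibar : (1 : ℝ) ∈ Ibar := by simp

theorem integral_I (g : ℝ → ℝ) : ∫ x in I, g x = ∫ x in (-1)..1, g x := by
  rw [intervalIntegral.integral_of_le (by norm_num), integral_Ioc_eq_integral_Ioo]

theorem intervalIntegrable_of_integrable {g : ℝ → ℝ} (hg : Integrable g (volume.restrict I)) :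
    IntervalIntegrable g volume (-1) 1 := by
  rw [intervalIntegrable_iff_integrableOn_Ioo_of_le (by norm_num)]
  exact hg

theorem MemL2.integrable {g : ℝ → ℝ} (hg : MemL2 g) : Integrable g (volume.restrict I) :=
  MemLp.integrable one_le_two hg

theorem MemL2.intervalIntegrable {g : ℝ → ℝ} (hg : MemL2 g) :
    IntervalIntegrable g volume (-1) 1 :=
  intervalIntegrable_of_integrable hg.integrable

theorem intervalIntegral_congr_ae_I {g k : ℝ → ℝ} (h : g =ᵐ[volume.restrict I] k) {a b : ℝ}
    (ha : a ∈ Ibar) (hb : b ∈ Ibar) : ∫ t in a..b, g t = ∫ t in a..b, k t := by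
  apply intervalIntegral.integral_congr_ae
  have h1 : ∀ᵐ x : ℝ, x ≠ 1 := by simp [ae_iff, measure_singleton]
  rw [Filter.EventuallyEq, ae_restrict_iff' measurableSet_Ioo] at h
  filter_upwards [h, h1] with x hx hx1 hxab
  have : -1 < x ∧ x ≤ 1 := by
    rcases le_total a b with hab | hab
    · rw [uIoc_of_le hab] at hxab; exact ⟨by linarith [ha.1, hxab.1], by linarith [hb.2, hxab.2]⟩
    · rw [uIoc_of_ge hab] at hxab; exact ⟨by linarith [hb.1, hxab.1], by linarith [ha.2, hxab.2]⟩
  exact hx ⟨this.1, lt_of_le_of_ne this.2 hx1⟩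

theorem memL2_of_continuousOn {g : ℝ → ℝ} (hg : ContinuousOn g Ibar) : MemL2 g := by
  obtain ⟨C, hC⟩ := isCompact_Icc.exists_bound_of_continuousOn hg
  refine MemLp.of_bound (C := C) ?_ ?_
  · exact (hg.mono Ioo_subset_Icc_self).aestronglyMeasurable measurableSet_Ioo
  · rw [ae_restrict_iff' measurableSet_Ioo]
    exact Filter.Eventually.of_forall fun x hx => hC x (Ioo_subset_Icc_self hx)

theorem isPrimitive_primitive {φ : ℝ → ℝ} (h : IntervalIntegrable φ volume (-1) 1) {a : ℝ}
    (ha : a ∈ Ibar) (c : ℝ) : IsPrimitive (fun x => c + ∫ t in a..x, φ t) φ := by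
  refine ⟨h, fun x hx => ?_⟩
  have := intervalIntegral.integral_add_adjacent_intervals
    (intervalIntegrable_mono h ha neg_one_mem_Ibar) (intervalIntegrable_mono h neg_one_mem_Ibar hx)
  linarith

namespace IsPrimitive

variable {F φ K k : ℝ → ℝ}

theorem integral_eq (h : IsPrimitive F φ) {a b : ℝ} (ha : a ∈ Ibar) (hb : b ∈ Ibar) :
    ∫ t in a..b, φ t = F b - F a := by
  have := intervalIntegral.integral_add_adjacent_intervals
    (intervalIntegrable_mono h.integrable neg_one_mem_Ibar ha)
    (intervalIntegrable_mono h.integrable ha hb)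
  rw [h.eq a ha, h.eq b hb]
  linarith

theorem add (h : IsPrimitive F φ) (h' : IsPrimitive K k) :
    IsPrimitive (fun x => F x + K x) (fun x => φ x + k x) := by
  refine ⟨h.integrable.add h'.integrable, fun x hx => ?_⟩
  rw [intervalIntegral.integral_add (intervalIntegrable_mono h.integrable neg_one_mem_Ibar hx)
    (intervalIntegrable_mono h'.integrable neg_one_mem_Ibar hx), h.eq x hx, h'.eq x hx]
  ring

theorem const_mul (h : IsPrimitive F φ) (c : ℝ) :
    IsPrimitive (fun x => c * F x) (fun x => c * φ x) := by
  refine ⟨h.integrable.const_mul c, fun x hx => ?_⟩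
  rw [intervalIntegral.integral_const_mul, h.eq x hx]
  ring

theorem sub (h : IsPrimitive F φ) (h' : IsPrimitive K k) :
    IsPrimitive (fun x => F x - K x) (fun x => φ x - k x) := by
  refine ⟨h.integrable.sub h'.integrable, fun x hx => ?_⟩
  rw [intervalIntegral.integral_sub (intervalIntegrable_mono h.integrable neg_one_mem_Ibar hx)
    (intervalIntegrable_mono h'.integrable neg_one_mem_Ibar hx), h.eq x hx, h'.eq x hx]
  ring

theorem congr (h : IsPrimitive F φ) (hk : EqOn F K Ibar) : IsPrimitive K φ := by
  refine ⟨h.integrable, fun x hx => ?_⟩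
  rw [← hk hx, ← hk neg_one_mem_Ibar, h.eq x hx]

/-- The integral formula replaces `F`, which is arbitrary off [-1,1]; its derivative is known almost
everywhere by Lebesgue differentiation. -/
theorem absolutelyContinuous (h : IsPrimitive F φ) :
    AbsolutelyContinuousOnInterval (fun x => F (-1) + ∫ t in (-1)..x, φ t) (-1) 1 := by
  have h1 := h.integrable.absolutelyContinuousOnInterval_intervalIntegral (c := -1) (by simp)
  have h2 : AbsolutelyContinuousOnInterval (fun _ : ℝ => F (-1)) (-1) 1 :=
    ((LipschitzWith.const (F (-1))).lipschitzOnWith (s := uIcc (-1) 1)).absolutelyContinuousOnInterval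
  exact h2.add h1

theorem continuousOn (h : IsPrimitive F φ) : ContinuousOn F Ibar := by
  have := h.absolutelyContinuous.continuousOn
  rw [uIcc_of_le (by norm_num : (-1 : ℝ) ≤ 1)] at this
  exact this.congr h.eq

theorem memL2 (h : IsPrimitive F φ) : MemL2 F := memL2_of_continuousOn h.continuousOn

theorem integral_mul (h : IsPrimitive F φ) (h' : IsPrimitive K k) :
    ∫ x in (-1)..1, F x * k x = F 1 * K 1 - F (-1) * K (-1) - ∫ x in (-1)..1, φ x * K x := by
  have key := h.absolutelyContinuous.integral_mul_deriv_eq_deriv_mul h'.absolutelyContinuous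
  have e : ∀ {F φ : ℝ → ℝ}, IsPrimitive F φ → ∀ᵐ x, x ∈ uIcc (-1 : ℝ) 1 →
      deriv (fun x => F (-1) + ∫ t in (-1)..x, φ t) x = φ x := by
    intro F φ h
    filter_upwards [h.integrable.ae_hasDerivAt_integral] with x hx hxI
    exact ((hx hxI (-1) (by simp)).const_add _).deriv
  have hs : uIoc (-1 : ℝ) 1 ⊆ Ibar := by
    rw [uIoc_of_le (by norm_num)]; exact Ioc_subset_Icc_self
  have e1 : ∫ x in (-1)..1, F x * k x = ∫ x in (-1)..1, (F (-1) + ∫ t in (-1)..x, φ t) *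
      deriv (fun x => K (-1) + ∫ t in (-1)..x, k t) x := by
    apply intervalIntegral.integral_congr_ae
    filter_upwards [e h'] with x hx hxI
    rw [hx (uIoc_subset_uIcc hxI), ← h.eq x (hs hxI)]
  have e2 : ∫ x in (-1)..1, φ x * K x = ∫ x in (-1)..1,
      deriv (fun x => F (-1) + ∫ t in (-1)..x, φ t) x * (K (-1) + ∫ t in (-1)..x, k t) := by
    apply intervalIntegral.integral_congr_ae
    filter_upwards [e h] with x hx hxI
    rw [hx (uIoc_subset_uIcc hxI), ← h'.eq x (hs hxI)]
  rw [e1, e2, key, ← h.eq 1 one_mem_Ibar, ← h'.eq 1 one_mem_Ibar, ← h.eq (-1) neg_one_mem_Ibar,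
    ← h'.eq (-1) neg_one_mem_Ibar]

theorem of_contDiff {θ : ℝ → ℝ} (h : ContDiff ℝ ∞ θ) : IsPrimitive θ (deriv θ) := by
  have hc : Continuous (deriv θ) := h.continuous_deriv (by simp)
  refine ⟨hc.intervalIntegrable _ _, fun x _ => ?_⟩
  rw [intervalIntegral.integral_deriv_eq_sub
    (fun y _ => (h.differentiable (by simp)).differentiableAt) (hc.intervalIntegrable _ _)]
  ring

theorem hasWeakDeriv (h : IsPrimitive F φ) : HasWeakDeriv F φ := by
  intro θ hθ _ hs
  have := h.integral_mul (of_contDiff hθ)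
  have h1 : θ 1 = 0 := image_eq_zero_of_notMem_tsupport fun hm => by simpa using hs hm
  have h2 : θ (-1) = 0 := image_eq_zero_of_notMem_tsupport fun hm => by simpa using hs hm
  rw [integral_I, integral_I, this, h1, h2]
  ring

end IsPrimitive

theorem exists_Icc_superset_of_isCompact {K : Set ℝ} (hK : IsCompact K) (hKI : K ⊆ I) :
    ∃ a b : ℝ, -1 < a ∧ b < 1 ∧ K ⊆ Icc a b := by
  rcases K.eq_empty_or_nonempty with rfl | hne
  · exact ⟨0, 0, by norm_num, by norm_num, empty_subset _⟩
  · obtain ⟨a, ha⟩ := hK.exists_isLeast hne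
    obtain ⟨b, hb⟩ := hK.exists_isGreatest hne
    exact ⟨a, b, (hKI ha.1).1, (hKI hb.1).2, fun x hx => ⟨ha.2 hx, hb.2 hx⟩⟩

/-- A test function of vanishing mean is the derivative of a test function. -/
theorem exists_testFunction_deriv_eq {k : ℝ → ℝ} (hk : ContDiff ℝ ∞ k) (hc : HasCompactSupport k)
    (hs : tsupport k ⊆ I) (h0 : ∫ x in (-1)..1, k x = 0) :
    ∃ φ : ℝ → ℝ, ContDiff ℝ ∞ φ ∧ HasCompactSupport φ ∧ tsupport φ ⊆ I ∧ deriv φ = k := by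
  obtain ⟨a, b, ha, hb, hab⟩ := exists_Icc_superset_of_isCompact hc hs
  have hkc : Continuous k := hk.continuous
  have hd : ∀ x, HasDerivAt (fun x => ∫ t in (-1)..x, k t) (k x) x := fun x =>
    intervalIntegral.integral_hasDerivAt_right (hkc.intervalIntegrable _ _)
      hkc.stronglyMeasurable.stronglyMeasurableAtFilter hkc.continuousAt
  have hderiv : deriv (fun x => ∫ t in (-1)..x, k t) = k := funext fun x => (hd x).deriv
  have hz : ∀ x, x ∉ Icc a b → k x = 0 := fun x hx =>
    image_eq_zero_of_notMem_tsupport fun hm => hx (hab hm)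
  have hsupp : tsupport (fun x => ∫ t in (-1)..x, k t) ⊆ Icc a b := by
    refine closure_minimal (fun x hx => ?_) isClosed_Icc
    by_contra hxab
    refine hx ?_
    rcases lt_or_ge x a with h | h
    · rw [← intervalIntegral.integral_zero (a := -1) (b := x) (μ := volume)]
      refine intervalIntegral.integral_congr fun t ht => hz t fun htab => ?_
      have : t ≤ max (-1) x := ht.2
      have := htab.1
      rcases le_max_iff.1 ‹t ≤ max (-1) x› with h' | h' <;> linarith
    · have hbx : b < x := by
        by_contra h'
        exact hxab ⟨h, not_lt.1 h'⟩
      -- Right of the support the primitive equals the full integral, which is zero by `h0`.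
      have h1 : ∫ t in x..1, k t = 0 := by
        rw [← intervalIntegral.integral_zero (a := x) (b := 1) (μ := volume)]
        refine intervalIntegral.integral_congr fun t ht => hz t fun htab => ?_
        have h2 : min x 1 ≤ t := ht.1
        have := htab.2
        rcases min_le_iff.1 h2 with h' | h' <;> linarith
      have := intervalIntegral.integral_add_adjacent_intervals
        (hkc.intervalIntegrable (μ := volume) (-1) x) (hkc.intervalIntegrable x 1)
      linarith
  refine ⟨fun x => ∫ t in (-1)..x, k t, ?_, ?_, ?_, hderiv⟩
  · rw [contDiff_infty_iff_deriv, hderiv]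
    exact ⟨fun x => (hd x).differentiableAt, hk⟩
  · exact isCompact_Icc.of_isClosed_subset (isClosed_tsupport _) hsupp
  · exact hsupp.trans fun x hx => ⟨lt_of_lt_of_le ha hx.1, lt_of_le_of_lt hx.2 hb⟩

theorem exists_testFunction_integral_eq_one :
    ∃ ρ : ℝ → ℝ, ContDiff ℝ ∞ ρ ∧ HasCompactSupport ρ ∧ tsupport ρ ⊆ I ∧ ∫ x in I, ρ x = 1 := by
  let B : ContDiffBump (0 : ℝ) := ⟨1 / 4, 1 / 2, by norm_num, by norm_num⟩
  have hts : tsupport (B.normed volume) ⊆ I := by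
    rw [B.tsupport_normed_eq, Real.closedBall_eq_Icc]
    intro x hx
    have h1 : (0 : ℝ) - 1 / 2 ≤ x := hx.1
    have h2 : x ≤ (0 : ℝ) + 1 / 2 := hx.2
    exact ⟨by linarith, by linarith⟩
  refine ⟨B.normed volume, B.contDiff_normed, B.hasCompactSupport_normed, hts, ?_⟩
  rw [setIntegral_eq_integral_of_forall_compl_eq_zero, B.integral_normed]
  exact fun x hx => image_eq_zero_of_notMem_tsupport fun hm => hx (hts hm)

/-- The lemma of du Bois-Reymond. -/
theorem ae_eq_const_of_hasWeakDeriv_zero {w : ℝ → ℝ} (hw : Integrable w (volume.restrict I))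
    (h : HasWeakDeriv w (fun _ => 0)) : ∃ C : ℝ, w =ᵐ[volume.restrict I] fun _ => C := by
  obtain ⟨ρ, hρd, hρc, hρs, hρ1⟩ := exists_testFunction_integral_eq_one
  have hint : ∀ θ : ℝ → ℝ, Continuous θ → HasCompactSupport θ →
      Integrable (fun x => w x * θ x) (volume.restrict I) := fun θ hθ hc => by
    obtain ⟨C, hC⟩ := hθ.bounded_above_of_compact_support hc
    exact hw.mul_bdd hθ.aestronglyMeasurable (Filter.Eventually.of_forall hC)
  set C := ∫ x in I, w x * ρ x
  have hconst : Integrable (fun _ : ℝ => C) (volume.restrict I) := integrable_const C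
  refine ⟨C, ?_⟩
  have key : ∀ᵐ x, x ∈ I → w x - C = 0 := by
    refine isOpen_Ioo.ae_eq_zero_of_integral_contDiff_smul_eq_zero
      (IntegrableOn.locallyIntegrableOn (hw.sub hconst)) fun θ hθ hθc hθs => ?_
    set m := ∫ x in I, θ x
    have hθi : Integrable θ (volume.restrict I) :=
      (hθ.continuous.integrable_of_hasCompactSupport hθc).integrableOn
    have hρi : Integrable ρ (volume.restrict I) :=
      (hρd.continuous.integrable_of_hasCompactSupport hρc).integrableOn
    -- Subtracting m ρ removes the mean of θ and leaves the derivative of a test function; this is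
    -- why C = ∫ w ρ is the right constant.
    have hk : ContDiff ℝ ∞ (fun x => θ x - m * ρ x) := hθ.sub (contDiff_const.mul hρd)
    have hkc : HasCompactSupport (fun x => θ x - m * ρ x) := hθc.sub hρc.mul_left
    have hks : tsupport (fun x => θ x - m * ρ x) ⊆ I :=
      (tsupport_sub _ _).trans (union_subset hθs ((tsupport_mul_subset_right).trans hρs))
    have hk0 : ∫ x in (-1)..1, (θ x - m * ρ x) = 0 := by
      rw [← integral_I, integral_sub hθi (hρi.const_mul m), integral_const_mul, hρ1]
      simp [m]
    obtain ⟨φ, hφ, hφc, hφs, hφd⟩ := exists_testFunction_deriv_eq hk hkc hks hk0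
    have h1 := h φ hφ hφc hφs
    have h2 : ∫ x in I, w x * deriv φ x = (∫ x in I, w x * θ x) - m * C := by
      rw [hφd, ← integral_const_mul, ← integral_sub (hint θ hθ.continuous hθc)
        ((hint ρ hρd.continuous hρc).const_mul m)]
      exact integral_congr_ae (Filter.Eventually.of_forall fun x => by ring)
    have h3 : ∫ x in I, θ x • (w x - C) = (∫ x in I, w x * θ x) - m * C := by
      rw [mul_comm m, ← integral_const_mul, ← integral_sub (hint θ hθ.continuous hθc)
        (hθi.const_mul C)]
      exact integral_congr_ae (Filter.Eventually.of_forall fun x => by simp only [smul_eq_mul]; ring)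
    rw [← setIntegral_eq_integral_of_forall_compl_eq_zero (s := I), h3, ← h2, h1]
    · simp
    · exact fun x hx => by
        rw [image_eq_zero_of_notMem_tsupport fun hm => hx (hθs hm), zero_smul]
  rw [Filter.EventuallyEq, ae_restrict_iff' measurableSet_Ioo]
  filter_upwards [key] with x hx hxI
  linarith [hx hxI]

/-- An integrable function with an integrable weak derivative is almost everywhere equal to a
primitive of the latter. -/
theorem HasWeakDeriv.exists_isPrimitive {v g : ℝ → ℝ} (hv : Integrable v (volume.restrict I))
    (hg : Integrable g (volume.restrict I)) (h : HasWeakDeriv v g) :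
    ∃ F : ℝ → ℝ, v =ᵐ[volume.restrict I] F ∧ IsPrimitive F g := by
  have hP := isPrimitive_primitive (intervalIntegrable_of_integrable hg) neg_one_mem_Ibar 0
  set P : ℝ → ℝ := fun x => 0 + ∫ t in (-1)..x, g t
  have hPi := hP.memL2.integrable
  have hz : HasWeakDeriv (fun x => v x - P x) (fun _ => 0) := by
    intro φ hφ hφc hφs
    have hφ' : Continuous (deriv φ) := hφ.continuous_deriv (by simp)
    obtain ⟨B, hB⟩ := hφ'.bounded_above_of_compact_support hφc.deriv
    have e1 : Integrable (fun x => v x * deriv φ x) (volume.restrict I) :=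
      hv.mul_bdd hφ'.aestronglyMeasurable (Filter.Eventually.of_forall hB)
    have e2 : Integrable (fun x => P x * deriv φ x) (volume.restrict I) :=
      hPi.mul_bdd hφ'.aestronglyMeasurable (Filter.Eventually.of_forall hB)
    simp only [sub_mul, zero_mul, integral_zero, neg_zero]
    rw [integral_sub e1 e2, h φ hφ hφc hφs, hP.hasWeakDeriv φ hφ hφc hφs, sub_self]
  obtain ⟨C, hC⟩ := ae_eq_const_of_hasWeakDeriv_zero (hv.sub hPi) hz
  refine ⟨fun x => C + ∫ t in (-1)..x, g t, ?_,
    isPrimitive_primitive (intervalIntegrable_of_integrable hg) neg_one_mem_Ibar C⟩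
  filter_upwards [hC] with x hx
  simp only [P, Pi.sub_apply] at hx
  linarith

theorem eqOn_Ibar_of_ae_eq {v w : ℝ → ℝ} (hv : ContinuousOn v Ibar) (hw : ContinuousOn w Ibar)
    (h : v =ᵐ[volume.restrict I] w) : EqOn v w Ibar := by
  have h1 : EqOn v w I := by
    have := Measure.eqOn_open_of_ae_eq h isOpen_Ioo (hv.mono Ioo_subset_Icc_self)
      (hw.mono Ioo_subset_Icc_self)
    exact this
  have : Ibar ⊆ closure I := by rw [closure_Ioo (by norm_num)]
  exact h1.of_subset_closure hv hw Ioo_subset_Icc_self this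

/-- Continuity up to the end points upgrades the almost everywhere identity to every point of
[-1,1]. All pointwise statements about `H2` rest on this. -/
theorem HasWeakDeriv.isPrimitive {v g : ℝ → ℝ} (hv : ContinuousOn v Ibar)
    (hg : Integrable g (volume.restrict I)) (h : HasWeakDeriv v g) : IsPrimitive v g := by
  obtain ⟨F, hF, hP⟩ := h.exists_isPrimitive (memL2_of_continuousOn hv).integrable hg
  exact hP.congr (eqOn_Ibar_of_ae_eq hv hP.continuousOn hF).symm

theorem H2.isPrimitive_val (v : H2) : IsPrimitive v.val v.d1 :=
  v.weak1.isPrimitive v.val_cont (memL2_of_continuousOn v.d1_cont).integrable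

theorem H2.isPrimitive_d1 (v : H2) : IsPrimitive v.d1 v.d2 :=
  v.weak2.isPrimitive v.d1_cont v.d2_mem.integrable

/-! ### Secant slopes of a convex function with a contact set -/

/-- If a convex function `G` is affine wherever `C > 0`, if `C ≥ 0` vanishes somewhere in the
interior and the secant slopes of `G + C` are at most `s`, then so are those of `G`. -/
theorem secant_le_of_contact {G C : ℝ → ℝ} {l r s z : ℝ} (hG : ContinuousOn G (Icc l r))
    (hconv : ConvexOn ℝ (Icc l r) G) (hC : ContinuousOn C (Icc l r))
    (hC0 : ∀ x ∈ Icc l r, 0 ≤ C x)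
    (haff : ∀ a d, l ≤ a → a < d → d ≤ r → (∀ x ∈ Ioo a d, 0 < C x) →
      ∀ b ∈ Ioo a d, (G b - G a) / (b - a) = (G d - G b) / (d - b))
    (hs : ∀ a b, l ≤ a → a ≤ b → b ≤ r → (G b + C b) - (G a + C a) ≤ s * (b - a))
    (hz : z ∈ Ioo l r) (hCz : C z = 0) {a b : ℝ} (hla : l ≤ a) (hab : a ≤ b) (hbr : b ≤ r) :
    G b - G a ≤ s * (b - a) := by
  -- Since C w = 0 ≤ C r, the secant of G from a contact point w to r is no steeper than that of G +
  -- C.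
  have hend : ∀ w, l ≤ w → w < r → C w = 0 → (G r - G w) / (r - w) ≤ s := by
    intro w hlw hwr hCw
    rw [div_le_iff₀ (by linarith)]
    have := hs w r hlw hwr.le le_rfl
    have := hC0 r ⟨by linarith, le_rfl⟩
    linarith
  have hadj : ∀ x y w, l ≤ x → x < y → y < w → w ≤ r →
      (G y - G x) / (y - x) ≤ (G w - G y) / (w - y) := fun x y w h1 h2 h3 h4 =>
    hconv.slope_mono_adjacent ⟨h1, by linarith⟩ ⟨by linarith, h4⟩ h2 h3
  have hopen : ∀ b, a < b → b < r → G b - G a ≤ s * (b - a) := by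
    intro b hab hbr
    rw [← div_le_iff₀ (by linarith)]
    -- With a contact point w in [b, r), convexity bounds the slope over [a, b] by the slope over
    -- [w, r].
    by_cases hex : ∃ w, b ≤ w ∧ w < r ∧ C w = 0
    · obtain ⟨w, hbw, hwr, hCw⟩ := hex
      have h2 := hend w (by linarith) hwr hCw
      rcases hbw.eq_or_lt with rfl | hbw
      · exact (hadj a b r hla hab hwr le_rfl).trans h2
      · exact ((hadj a b w hla hab hbw hwr.le).trans
          (hadj b w r (by linarith) hbw hwr le_rfl)).trans h2
    -- Otherwise all contact points before r lie left of b. Beyond the last of them, w, the function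
    -- is affine up to r, so the slope over [b, r] is the slope over [w, r].
    · push Not at hex
      have hzb : z < b := by
        by_contra h
        exact hex z (not_lt.1 h) hz.2 hCz
      have hcpt : IsCompact (Icc l b ∩ C ⁻¹' {0}) :=
        isCompact_Icc.of_isClosed_subset
          ((hC.mono (Icc_subset_Icc_right hbr.le)).preimage_isClosed_of_isClosed isClosed_Icc
            isClosed_singleton) inter_subset_left
      obtain ⟨w, ⟨hw, hCw⟩, hwm⟩ := hcpt.exists_isGreatest ⟨z, ⟨hz.1.le, hzb.le⟩, hCz⟩
      have hCw : C w = 0 := hCw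
      have hwb : w < b := lt_of_le_of_ne hw.2 fun h => hex b le_rfl hbr (h ▸ hCw)
      have hpos : ∀ x ∈ Ioo w r, 0 < C x := by
        intro x hx
        refine lt_of_le_of_ne (hC0 x ⟨by linarith [hw.1, hx.1], hx.2.le⟩) fun h0 => ?_
        rcases le_total b x with h | h
        · exact hex x h hx.2 h0.symm
        · exact absurd (hwm ⟨⟨by linarith [hw.1, hx.1], h⟩, h0.symm⟩) (not_le.2 hx.1)
      have he := haff w r hw.1 (by linarith) le_rfl hpos b ⟨hwb, hbr⟩
      have h2 := hend w hw.1 (by linarith) hCw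
      have h3 : (G r - G b) / (r - b) ≤ s := by
        rw [div_eq_div_iff (by linarith) (by linarith)] at he
        rw [div_le_iff₀ (by linarith)] at h2 ⊢
        have h4 : (G r - G b) * (r - w) = (G r - G w) * (r - b) := by linarith
        nlinarith [mul_le_mul_of_nonneg_right h2 (by linarith : 0 ≤ r - b)]
      exact (hadj a b r hla hab hbr le_rfl).trans h3
  rcases hab.eq_or_lt with rfl | hab
  · simp
  rcases hbr.lt_or_eq with hbr | rfl
  · exact hopen b hab hbr
  · have hcl : closure (Ioo a b) = Icc a b := closure_Ioo hab.ne
    have hsub : Icc a b ⊆ Icc l b := Icc_subset_Icc_left hla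
    refine le_on_closure (s := Ioo a b) (f := fun x => G x - G a) (g := fun x => s * (x - a))
      (fun x hx => hopen x hx.1 hx.2) ?_ ?_ ?_
    · rw [hcl]; exact (hG.mono hsub).sub continuousOn_const
    · fun_prop
    · rw [hcl]; exact right_mem_Icc.2 hab.le

/-- The reflected version of `secant_le_of_contact`. -/
theorem le_secant_of_contact {G C : ℝ → ℝ} {l r s z : ℝ} (hG : ContinuousOn G (Icc l r))
    (hconv : ConvexOn ℝ (Icc l r) G) (hC : ContinuousOn C (Icc l r))
    (hC0 : ∀ x ∈ Icc l r, 0 ≤ C x)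
    (haff : ∀ a d, l ≤ a → a < d → d ≤ r → (∀ x ∈ Ioo a d, 0 < C x) →
      ∀ b ∈ Ioo a d, (G b - G a) / (b - a) = (G d - G b) / (d - b))
    (hs : ∀ a b, l ≤ a → a ≤ b → b ≤ r → s * (b - a) ≤ (G b + C b) - (G a + C a))
    (hz : z ∈ Ioo l r) (hCz : C z = 0) {a b : ℝ} (hla : l ≤ a) (hab : a ≤ b) (hbr : b ≤ r) :
    s * (b - a) ≤ G b - G a := by
  have hmaps : MapsTo (fun x : ℝ => -x) (Icc (-r) (-l)) (Icc l r) := fun x hx =>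
    ⟨by linarith [hx.2], by linarith [hx.1]⟩
  have hneg : ContinuousOn (fun x : ℝ => -x) (Icc (-r) (-l)) := continuousOn_neg
  have key := secant_le_of_contact (G := fun x => G (-x)) (C := fun x => C (-x)) (l := -r) (r := -l)
    (s := -s) (z := -z) (hG.comp hneg hmaps) ?_ (hC.comp hneg hmaps) (fun x hx => hC0 _ (hmaps hx))
    ?_ ?_ ⟨by linarith [hz.2], by linarith [hz.1]⟩ (by simpa using hCz) (a := -b) (b := -a)
    (by linarith) (by linarith) (by linarith)
  · simp only [neg_neg] at key
    linarith
  · refine ⟨convex_Icc _ _, fun x hx y hy p q hp hq hpq => ?_⟩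
    have := hconv.2 (hmaps hx) (hmaps hy) hp hq hpq
    simp only [smul_eq_mul] at this ⊢
    rwa [show -(p * x + q * y) = p * -x + q * -y by ring]
  · intro a d ha had hd hpos b hb
    have := haff (-d) (-a) (by linarith) (by linarith) (by linarith)
      (fun x hx => by
        have := hpos (-x) ⟨by linarith [hx.2], by linarith [hx.1]⟩
        simpa using this) (-b) ⟨by linarith [hb.2], by linarith [hb.1]⟩
    have e1 : (G (-b) - G (-a)) / (b - a) = - ((G (-a) - G (-b)) / (-a - -b)) := by
      rw [← neg_div]; congr 1 <;> ring
    have e2 : (G (-d) - G (-b)) / (d - b) = - ((G (-b) - G (-d)) / (-b - -d)) := by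
      rw [← neg_div]; congr 1 <;> ring
    rw [e1, e2, this]
  · intro a b ha hab hb
    have := hs (-b) (-a) (by linarith) (by linarith) (by linarith)
    linarith

/-! ### Piecewise affine test functions -/

/-- The positive part of `x - a`, used to build piecewise affine test functions. -/
noncomputable def ramp (a x : ℝ) : ℝ := max (x - a) 0

/-- The right derivative of `ramp a`. -/
noncomputable def rampDeriv (a : ℝ) : ℝ → ℝ := indicator (Ici a) 1

theorem memL2_rampDeriv (a : ℝ) : MemL2 (rampDeriv a) := by
  refine MemLp.of_bound (C := 1) ?_ ?_
  · exact (measurable_one.indicator measurableSet_Ici).aestronglyMeasurable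
  · refine Filter.Eventually.of_forall fun x => ?_
    by_cases h : x ∈ Ici a <;> simp [rampDeriv, h]

theorem isPrimitive_ramp (a : ℝ) : IsPrimitive (ramp a) (rampDeriv a) := by
  refine ⟨(memL2_rampDeriv a).intervalIntegrable, fun x hx => ?_⟩
  rw [intervalIntegral.integral_eq_sub_of_hasDeriv_right (f := ramp a)]
  · ring
  · unfold ramp; fun_prop
  · intro y _
    by_cases h : a ≤ y
    · have h1 : HasDerivWithinAt (fun x => x - a) 1 (Ioi y) y :=
        ((hasDerivAt_id y).sub_const a).hasDerivWithinAt
      have : rampDeriv a y = 1 := by simp [rampDeriv, h]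
      rw [this]
      refine h1.congr (fun w hw => ?_) ?_
      · have : y < w := hw
        exact max_eq_left (by linarith)
      · exact max_eq_left (by linarith)
    · have h1 : HasDerivAt (fun _ : ℝ => (0 : ℝ)) 0 y := hasDerivAt_const _ _
      have : rampDeriv a y = 0 := by simp [rampDeriv, h]
      rw [this]
      refine (h1.congr_of_eventuallyEq ?_).hasDerivWithinAt
      filter_upwards [eventually_lt_nhds (not_le.1 h)] with w hw
      exact max_eq_right (by linarith)
  · exact intervalIntegrable_mono (memL2_rampDeriv a).intervalIntegrable neg_one_mem_Ibar hx

theorem isPrimitive_const (k : ℝ) : IsPrimitive (fun _ => k) (fun _ => 0) :=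
  ⟨by simp, fun x _ => by simp⟩

theorem MemL2.const_mul {g : ℝ → ℝ} (hg : MemL2 g) (c : ℝ) : MemL2 (fun x => c * g x) :=
  MemLp.const_mul hg c

theorem MemL2.add {g k : ℝ → ℝ} (hg : MemL2 g) (hk : MemL2 k) : MemL2 (fun x => g x + k x) :=
  MemLp.add hg hk

theorem MemL2.sub {g k : ℝ → ℝ} (hg : MemL2 g) (hk : MemL2 k) : MemL2 (fun x => g x - k x) :=
  MemLp.sub hg hk

theorem MemL2.mul {g k : ℝ → ℝ} (hg : MemL2 g) (hk : MemL2 k) :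
    IntervalIntegrable (fun x => g x * k x) volume (-1) 1 :=
  intervalIntegrable_of_integrable (MemLp.integrable_mul hg hk)

theorem integral_mul_rampDeriv {G : ℝ → ℝ} (hG : MemL2 G) {a : ℝ} (ha : a ∈ Ibar) :
    ∫ x in (-1)..1, G x * rampDeriv a x = ∫ x in a..1, G x := by
  have h := (hG.mul (memL2_rampDeriv a))
  rw [← intervalIntegral.integral_add_adjacent_intervals
    (intervalIntegrable_mono h neg_one_mem_Ibar ha) (intervalIntegrable_mono h ha one_mem_Ibar)]
  have h1 : ∫ x in (-1)..a, G x * rampDeriv a x = 0 := by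
    rw [← intervalIntegral.integral_zero (a := -1) (b := a) (μ := volume)]
    apply intervalIntegral.integral_congr_ae
    have h1 : ∀ᵐ x : ℝ, x ≠ a := by simp [ae_iff, measure_singleton]
    filter_upwards [h1] with x hx hxa
    rw [uIoc_of_le ha.1] at hxa
    have : ¬ a ≤ x := not_le.2 (lt_of_le_of_ne hxa.2 hx)
    simp [rampDeriv, this]
  have h2 : ∫ x in a..1, G x * rampDeriv a x = ∫ x in a..1, G x := by
    refine intervalIntegral.integral_congr fun x hx => ?_
    rw [uIcc_of_le ha.2] at hx
    simp [rampDeriv, hx.1]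
  rw [h1, h2, zero_add]

/-! ### The obstacle problem: convexity and oscillation of the residual -/

/-- The variational inequality of an obstacle problem with gap `c` to the obstacle and residual `G`,
where `G + β c'` is the absolutely continuous function `E`. -/
structure ObstacleVI (β : ℝ) (G c E e : ℝ → ℝ) : Prop where
  pos : 0 < β
  memL2 : MemL2 G
  gap_cont : ContinuousOn c Ibar
  gap_nonneg : ∀ x ∈ Ibar, 0 ≤ c x
  -- No condition is imposed on q at -1, where the slope of a state is free; `left_test` exploits
  -- this.
  vi : ∀ q r : ℝ → ℝ, IsPrimitive q r → MemL2 r → q 1 = 0 → (∀ x ∈ Ibar, q x ≤ c x) →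
    0 ≤ ∫ x in (-1)..1, G x * r x
  reg : IsPrimitive E e
  -- The identity G = E - βc' in integrated form.
  rel : ∀ a ∈ Ibar, ∀ b ∈ Ibar, ∫ x in a..b, G x = (∫ x in a..b, E x) - β * (c b - c a)

namespace ObstacleVI

variable {β : ℝ} {G c E e : ℝ → ℝ}

theorem isPrimitive (h : ObstacleVI β G c E e) : IsPrimitive (fun x => ∫ t in (-1)..x, G t) G :=
  (isPrimitive_primitive h.memL2.intervalIntegrable neg_one_mem_Ibar 0).congr
    fun x _ => by simp

theorem integral_tail (h : ObstacleVI β G c E e) {a : ℝ} (ha : a ∈ Ibar) :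
    ∫ x in a..1, G x = (∫ t in (-1)..1, G t) - ∫ t in (-1)..a, G t :=
  h.isPrimitive.integral_eq ha one_mem_Ibar

/-- Testing with a multiple of a hat function. -/
theorem hat_test (h : ObstacleVI β G c E e) {a b d k : ℝ} (ha : a ∈ Ibar) (hb : b ∈ Ibar)
    (hd : d ∈ Ibar)
    (hq : ∀ x ∈ Ibar, k * ((d - b) * ramp a x - (d - a) * ramp b x + (b - a) * ramp d x) ≤ c x) :
    0 ≤ k * (-(d - b) * (∫ t in (-1)..a, G t) + (d - a) * (∫ t in (-1)..b, G t)
      - (b - a) * (∫ t in (-1)..d, G t)) := by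
  have hP := (((isPrimitive_ramp a).const_mul (d - b)).sub
    ((isPrimitive_ramp b).const_mul (d - a))).add ((isPrimitive_ramp d).const_mul (b - a))
  have hm := (((memL2_rampDeriv a).const_mul (d - b)).sub
    ((memL2_rampDeriv b).const_mul (d - a))).add ((memL2_rampDeriv d).const_mul (b - a))
  have h1 := h.vi _ _ (hP.const_mul k) (hm.const_mul k) (by
    simp only [ramp]
    rw [max_eq_left (by linarith [ha.2]), max_eq_left (by linarith [hb.2]),
      max_eq_left (by linarith [hd.2])]
    ring) hq
  have e1 : ∫ x in (-1)..1, G x * (k * ((d - b) * rampDeriv a x - (d - a) * rampDeriv b x +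
      (b - a) * rampDeriv d x)) = k * ((d - b) * (∫ x in (-1)..1, G x * rampDeriv a x)
      - (d - a) * (∫ x in (-1)..1, G x * rampDeriv b x)
      + (b - a) * (∫ x in (-1)..1, G x * rampDeriv d x)) := by
    rw [← intervalIntegral.integral_const_mul, ← intervalIntegral.integral_const_mul,
      ← intervalIntegral.integral_const_mul, ← intervalIntegral.integral_sub, ← intervalIntegral.integral_add,
      ← intervalIntegral.integral_const_mul]
    · refine intervalIntegral.integral_congr fun x _ => ?_
      ring
    · exact ((h.memL2.mul (memL2_rampDeriv a)).const_mul _).sub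
        ((h.memL2.mul (memL2_rampDeriv b)).const_mul _)
    · exact (h.memL2.mul (memL2_rampDeriv d)).const_mul _
    · exact (h.memL2.mul (memL2_rampDeriv a)).const_mul _
    · exact (h.memL2.mul (memL2_rampDeriv b)).const_mul _
  rw [e1, integral_mul_rampDeriv h.memL2 ha, integral_mul_rampDeriv h.memL2 hb,
    integral_mul_rampDeriv h.memL2 hd, h.integral_tail ha, h.integral_tail hb,
    h.integral_tail hd] at h1
  convert h1 using 2
  ring

/-- Testing with a multiple of the function `(d - x)⁺`. -/
theorem left_test (h : ObstacleVI β G c E e) {d k : ℝ} (hd : d ∈ Ibar)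
    (hq : ∀ x ∈ Ibar, k * (ramp d x - (x - d)) ≤ c x) :
    0 ≤ -k * ∫ t in (-1)..d, G t := by
  have hP := (isPrimitive_ramp d).sub ((isPrimitive_ramp (-1)).add (isPrimitive_const (-1 - d)))
  have hm := (memL2_rampDeriv d).sub ((memL2_rampDeriv (-1)).add
    (memL2_of_continuousOn (g := fun _ => (0 : ℝ)) continuousOn_const))
  have h1 := h.vi _ _ (hP.const_mul k) (hm.const_mul k) (by
    simp only [ramp]
    rw [max_eq_left (by linarith [hd.2]), max_eq_left (by norm_num)]
    ring) (fun x hx => by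
      convert hq x hx using 3
      simp only [ramp]
      rw [max_eq_left (by linarith [hx.1] : 0 ≤ x - -1)]
      ring)
  have e1 : ∫ x in (-1)..1, G x * (k * (rampDeriv d x - (rampDeriv (-1) x + 0))) =
      k * ((∫ x in (-1)..1, G x * rampDeriv d x) - ∫ x in (-1)..1, G x * rampDeriv (-1) x) := by
    rw [← intervalIntegral.integral_sub, ← intervalIntegral.integral_const_mul]
    · refine intervalIntegral.integral_congr fun x _ => ?_
      ring
    · exact h.memL2.mul (memL2_rampDeriv d)
    · exact h.memL2.mul (memL2_rampDeriv (-1))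
  rw [e1, integral_mul_rampDeriv h.memL2 hd, integral_mul_rampDeriv h.memL2 neg_one_mem_Ibar,
    h.integral_tail hd] at h1
  linarith

/-- The combination of ramps is the hat function supported on [a, d] with peak (d - b)(b - a) at b.
-/
theorem ramp_hat_nonneg {a b d : ℝ} (hab : a < b) (hbd : b < d) (x : ℝ) :
    0 ≤ (d - b) * ramp a x - (d - a) * ramp b x + (b - a) * ramp d x := by
  simp only [ramp]
  rcases le_total x a with h1 | h1
  · rw [max_eq_right (by linarith), max_eq_right (by linarith), max_eq_right (by linarith)]
    simp
  rcases le_total x b with h2 | h2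
  · rw [max_eq_left (by linarith), max_eq_right (by linarith), max_eq_right (by linarith)]
    nlinarith
  rcases le_total x d with h3 | h3
  · rw [max_eq_left (by linarith), max_eq_left (by linarith), max_eq_right (by linarith)]
    nlinarith
  · rw [max_eq_left (by linarith), max_eq_left (by linarith), max_eq_left (by linarith)]
    nlinarith

theorem ramp_hat_le {a b d : ℝ} (hab : a < b) (hbd : b < d) (x : ℝ) :
    (d - b) * ramp a x - (d - a) * ramp b x + (b - a) * ramp d x ≤ (d - b) * (b - a) := by
  simp only [ramp]
  have := mul_pos (sub_pos.2 hab) (sub_pos.2 hbd)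
  rcases le_total x a with h1 | h1
  · rw [max_eq_right (by linarith), max_eq_right (by linarith), max_eq_right (by linarith)]
    nlinarith
  rcases le_total x b with h2 | h2
  · rw [max_eq_left (by linarith), max_eq_right (by linarith), max_eq_right (by linarith)]
    nlinarith
  rcases le_total x d with h3 | h3
  · rw [max_eq_left (by linarith), max_eq_left (by linarith), max_eq_right (by linarith)]
    nlinarith
  · rw [max_eq_left (by linarith), max_eq_left (by linarith), max_eq_left (by linarith)]
    nlinarith

theorem ramp_hat_eq_zero {a b d : ℝ} (hab : a < b) (hbd : b < d) {x : ℝ} (hx : x ∉ Icc a d) :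
    (d - b) * ramp a x - (d - a) * ramp b x + (b - a) * ramp d x = 0 := by
  simp only [ramp]
  rcases lt_or_ge x a with h1 | h1
  · rw [max_eq_right (by linarith), max_eq_right (by linarith), max_eq_right (by linarith)]
    ring
  · have : d < x := by
      by_contra h
      exact hx ⟨h1, not_lt.1 h⟩
    rw [max_eq_left (by linarith), max_eq_left (by linarith), max_eq_left (by linarith)]
    ring

/-- A negative hat function stays below every nonnegative gap, so it is always admissible; the
resulting inequality compares adjacent secant slopes. -/
theorem convexOn (h : ObstacleVI β G c E e) : ConvexOn ℝ Ibar (fun x => ∫ t in (-1)..x, G t) := by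
  refine convexOn_of_slope_mono_adjacent (convex_Icc _ _) fun {x y z} hx hz hxy hyz => ?_
  have hy : y ∈ Ibar := ⟨by linarith [hx.1], by linarith [hz.2]⟩
  have := h.hat_test (k := -1) hx hy hz fun t ht => by
    linarith [h.gap_nonneg t ht, ramp_hat_nonneg hxy hyz t]
  rw [div_le_div_iff₀ (by linarith) (by linarith)]
  linarith

/-- The function -(d - x)⁺ is an admissible direction because nothing is prescribed at -1. -/
theorem integral_nonneg (h : ObstacleVI β G c E e) {d : ℝ} (hd : d ∈ Ibar) :
    0 ≤ ∫ t in (-1)..d, G t := by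
  have := h.left_test (k := -1) hd fun t ht => by
    have : t - d ≤ ramp d t := le_max_left _ _
    linarith [h.gap_nonneg t ht]
  linarith

theorem exists_gap_lower_bound (h : ObstacleVI β G c E e) {a d : ℝ} (ha : a ∈ Ibar) (hd : d ∈ Ibar)
    (had : a ≤ d) (hpos : ∀ x ∈ Icc a d, 0 < c x) : ∃ δ > 0, ∀ x ∈ Icc a d, δ ≤ c x := by
  obtain ⟨w, hw, hwm⟩ := isCompact_Icc.exists_isMinOn (nonempty_Icc.2 had)
    (h.gap_cont.mono (Icc_subset_Icc ha.1 hd.2))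
  exact ⟨c w, hpos w hw, fun x hx => hwm hx⟩

/-- Where the gap is bounded below by δ > 0, small hats of both signs are admissible, and the two
inequalities make adjacent slopes equal. -/
theorem affine_of_gap_pos_Icc (h : ObstacleVI β G c E e) {a b d : ℝ} (ha : a ∈ Ibar)
    (hd : d ∈ Ibar) (hab : a < b) (hbd : b < d) (hpos : ∀ x ∈ Icc a d, 0 < c x) :
    (d - b) * ((∫ t in (-1)..b, G t) - ∫ t in (-1)..a, G t) =
      (b - a) * ((∫ t in (-1)..d, G t) - ∫ t in (-1)..b, G t) := by
  have hb : b ∈ Ibar := ⟨by linarith [ha.1], by linarith [hd.2]⟩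
  obtain ⟨δ, hδ, hδc⟩ := h.exists_gap_lower_bound ha hd (by linarith) hpos
  have hm := mul_pos (sub_pos.2 hbd) (sub_pos.2 hab)
  have h1 := h.hat_test (k := -1) ha hb hd fun t ht => by
    linarith [h.gap_nonneg t ht, ramp_hat_nonneg hab hbd t]
  have h2 := h.hat_test (k := δ / ((d - b) * (b - a))) ha hb hd fun t ht => by
    by_cases hta : t ∈ Icc a d
    · calc _ ≤ δ / ((d - b) * (b - a)) * ((d - b) * (b - a)) :=
            mul_le_mul_of_nonneg_left (ramp_hat_le hab hbd t) (by positivity)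
        _ = δ := div_mul_cancel₀ _ hm.ne'
        _ ≤ c t := hδc t hta
    · rw [ramp_hat_eq_zero hab hbd hta, mul_zero]
      exact h.gap_nonneg t ht
  have h3 := nonneg_of_mul_nonneg_right h2 (by positivity)
  linarith

/-- The gap may vanish at a and d, so the closed version is applied to smaller intervals and both
end points are moved outwards by continuity. -/
theorem affine_of_gap_pos (h : ObstacleVI β G c E e) {a b d : ℝ} (ha : a ∈ Ibar)
    (hd : d ∈ Ibar) (hb : b ∈ Ioo a d) (hpos : ∀ x ∈ Ioo a d, 0 < c x) :
    (d - b) * ((∫ t in (-1)..b, G t) - ∫ t in (-1)..a, G t) =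
      (b - a) * ((∫ t in (-1)..d, G t) - ∫ t in (-1)..b, G t) := by
  have hcont := h.isPrimitive.continuousOn
  have hs1 : Icc a b ⊆ Ibar := Icc_subset_Icc ha.1 (by linarith [hb.2, hd.2])
  have hs2 : Icc b d ⊆ Ibar := Icc_subset_Icc (by linarith [hb.1, ha.1]) hd.2
  have key : ∀ a' ∈ Ioo a b, ∀ d' ∈ Ioo b d,
      (d' - b) * ((∫ t in (-1)..b, G t) - ∫ t in (-1)..a', G t) =
      (b - a') * ((∫ t in (-1)..d', G t) - ∫ t in (-1)..b, G t) := fun a' ha' d' hd' =>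
    h.affine_of_gap_pos_Icc (hs1 (Ioo_subset_Icc_self ha')) (hs2 (Ioo_subset_Icc_self hd')) ha'.2
      hd'.1 fun x hx => hpos x ⟨by linarith [hx.1, ha'.1], by linarith [hx.2, hd'.2]⟩
  have hc1 : closure (Ioo a b) = Icc a b := closure_Ioo hb.1.ne
  have hc2 : closure (Ioo b d) = Icc b d := closure_Ioo hb.2.ne
  have key2 : ∀ d' ∈ Ioo b d, (d' - b) * ((∫ t in (-1)..b, G t) - ∫ t in (-1)..a, G t) =
      (b - a) * ((∫ t in (-1)..d', G t) - ∫ t in (-1)..b, G t) := fun d' hd' =>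
    (show EqOn (fun a' => (d' - b) * ((∫ t in (-1)..b, G t) - ∫ t in (-1)..a', G t))
      (fun a' => (b - a') * ((∫ t in (-1)..d', G t) - ∫ t in (-1)..b, G t)) (Ioo a b) from
      fun a' ha' => key a' ha' d' hd').of_subset_closure
      (continuousOn_const.mul (continuousOn_const.sub (hcont.mono hs1)))
      (by fun_prop) Ioo_subset_Icc_self hc1.ge (left_mem_Icc.2 hb.1.le)
  exact (show EqOn (fun d' => (d' - b) * ((∫ t in (-1)..b, G t) - ∫ t in (-1)..a, G t))
      (fun d' => (b - a) * ((∫ t in (-1)..d', G t) - ∫ t in (-1)..b, G t)) (Ioo b d) from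
      key2).of_subset_closure (by fun_prop)
      (continuousOn_const.mul ((hcont.mono hs2).sub continuousOn_const))
      Ioo_subset_Icc_self hc2.ge (right_mem_Icc.2 hb.2.le)

/-- Left of the contact set the residual vanishes. -/
theorem integral_eq_zero_of_gap_pos (h : ObstacleVI β G c E e) {d : ℝ} (hd : d ∈ Ibar)
    (hpos : ∀ x ∈ Ico (-1) d, 0 < c x) : ∫ t in (-1)..d, G t = 0 := by
  have key : ∀ d' ∈ Ico (-1) d, ∫ t in (-1)..d', G t = 0 := by
    intro d' hd'
    have hd'I : d' ∈ Ibar := ⟨hd'.1, by linarith [hd'.2, hd.2]⟩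
    obtain ⟨δ, hδ, hδc⟩ := h.exists_gap_lower_bound neg_one_mem_Ibar hd'I hd'.1
      fun x hx => hpos x ⟨hx.1, by linarith [hx.2, hd'.2]⟩
    -- The factor 1/2 compensates (d' - x)⁺ ≤ 2 on [-1,1].
    have h2 := h.left_test (k := δ / 2) hd'I fun x hx => by
      rcases le_total x d' with hx' | hx'
      · simp only [ramp]
        rw [max_eq_right (by linarith)]
        have := hδc x ⟨hx.1, hx'⟩
        have : d' - x ≤ 2 := by linarith [hx.1, hd'I.2]
        nlinarith
      · simp only [ramp]
        rw [max_eq_left (by linarith)]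
        linarith [h.gap_nonneg x hx]
    have h3 := h.integral_nonneg hd'I
    nlinarith
  rcases hd.1.eq_or_lt with rfl | hlt
  · simp
  · have hc1 : closure (Ico (-1) d) = Icc (-1) d := closure_Ico hlt.ne
    exact (show EqOn (fun d' => ∫ t in (-1)..d', G t) (fun _ => 0) (Ico (-1) d) from
      key).of_subset_closure (h.isPrimitive.continuousOn.mono (Icc_subset_Icc_right hd.2))
      continuousOn_const Ico_subset_Icc_self hc1.ge (right_mem_Icc.2 hlt.le)

/-- The bounds `lo` and `hi` are the minimum and maximum of E on [l, r]. The secants of (∫ G) + βc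
are averages of E, and the contact lemmas transfer their bounds to ∫ G. Integrating E - G = βc' from
the contact point z then bounds the gap. -/
theorem secant_bounds_of_contact (h : ObstacleVI β G c E e) {l r z : ℝ} (hl : l ∈ Ibar)
    (hr : r ∈ Ibar) (hz : z ∈ Ioo l r) (hcz : c z = 0) :
    ∃ lo hi : ℝ, lo ≤ hi ∧ hi - lo ≤ ∫ t in l..r, |e t| ∧
      (∀ a b, l ≤ a → a ≤ b → b ≤ r → lo * (b - a) ≤ ∫ t in a..b, G t ∧
        ∫ t in a..b, G t ≤ hi * (b - a)) ∧
      ∀ x ∈ Icc l r, β * c x ≤ (r - l) * (hi - lo) := by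
  have hlr : l ≤ r := by linarith [hz.1, hz.2]
  have hsub : Icc l r ⊆ Ibar := Icc_subset_Icc hl.1 hr.2
  have hE : ContinuousOn E (Icc l r) := h.reg.continuousOn.mono hsub
  obtain ⟨u, hu, hum⟩ := isCompact_Icc.exists_isMinOn (nonempty_Icc.2 hlr) hE
  obtain ⟨w, hw, hwm⟩ := isCompact_Icc.exists_isMaxOn (nonempty_Icc.2 hlr) hE
  have hEint : ∀ a b, l ≤ a → a ≤ b → b ≤ r → E u * (b - a) ≤ ∫ t in a..b, E t ∧
      ∫ t in a..b, E t ≤ E w * (b - a) := by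
    intro a b ha hab hb
    have hi : IntervalIntegrable E volume a b := by
      apply ContinuousOn.intervalIntegrable
      rw [uIcc_of_le hab]
      exact hE.mono (Icc_subset_Icc ha hb)
    constructor
    · have := intervalIntegral.integral_mono_on hab (intervalIntegrable_const (c := E u)) hi
        fun x hx => hum ⟨ha.trans hx.1, hx.2.trans hb⟩
      simpa [mul_comm] using this
    · have := intervalIntegral.integral_mono_on hab hi (intervalIntegrable_const (c := E w))
        fun x hx => hwm ⟨ha.trans hx.1, hx.2.trans hb⟩
      simpa [mul_comm] using this
  have hrel : ∀ a b, l ≤ a → a ≤ b → b ≤ r → ∫ t in a..b, E t =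
      ((∫ t in (-1)..b, G t) + β * c b) - ((∫ t in (-1)..a, G t) + β * c a) := by
    intro a b ha hab hb
    have haI : a ∈ Ibar := hsub ⟨ha, hab.trans hb⟩
    have hbI : b ∈ Ibar := hsub ⟨ha.trans hab, hb⟩
    have h1 := h.rel a haI b hbI
    have h2 := h.isPrimitive.integral_eq haI hbI
    linarith
  have hG : ContinuousOn (fun x => ∫ t in (-1)..x, G t) (Icc l r) :=
    h.isPrimitive.continuousOn.mono hsub
  have hconv := h.convexOn.subset hsub (convex_Icc l r)
  have hC : ContinuousOn (fun x => β * c x) (Icc l r) :=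
    continuousOn_const.mul (h.gap_cont.mono hsub)
  have hC0 : ∀ x ∈ Icc l r, 0 ≤ β * c x := fun x hx =>
    mul_nonneg h.pos.le (h.gap_nonneg x (hsub hx))
  have haff : ∀ a d, l ≤ a → a < d → d ≤ r → (∀ x ∈ Ioo a d, 0 < β * c x) →
      ∀ b ∈ Ioo a d, ((∫ t in (-1)..b, G t) - ∫ t in (-1)..a, G t) / (b - a) =
        ((∫ t in (-1)..d, G t) - ∫ t in (-1)..b, G t) / (d - b) := by
    intro a d ha had hd hpos b hb
    have := h.affine_of_gap_pos (hsub ⟨ha, had.le.trans hd⟩) (hsub ⟨ha.trans had.le, hd⟩) hb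
      fun x hx => pos_of_mul_pos_right (hpos x hx) h.pos.le
    rw [div_eq_div_iff (by linarith [hb.1]) (by linarith [hb.2])]
    linarith
  have hslope : ∀ a b, l ≤ a → a ≤ b → b ≤ r → E u * (b - a) ≤ ∫ t in a..b, G t ∧
      ∫ t in a..b, G t ≤ E w * (b - a) := by
    intro a b ha hab hb
    rw [h.isPrimitive.integral_eq (hsub ⟨ha, hab.trans hb⟩) (hsub ⟨ha.trans hab, hb⟩)]
    constructor
    · exact le_secant_of_contact hG hconv hC hC0 haff (fun a b ha hab hb => by
        rw [← hrel a b ha hab hb]; exact (hEint a b ha hab hb).1) hz (by rw [hcz, mul_zero])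
        ha hab hb
    · exact secant_le_of_contact hG hconv hC hC0 haff (fun a b ha hab hb => by
        rw [← hrel a b ha hab hb]; exact (hEint a b ha hab hb).2) hz (by rw [hcz, mul_zero])
        ha hab hb
  refine ⟨E u, E w, hum hw, ?_, hslope, fun x hx => ?_⟩
  · rw [← h.reg.integral_eq (hsub hu) (hsub hw)]
    have habs : IntervalIntegrable (fun t => |e t|) volume l r :=
      (intervalIntegrable_mono h.reg.integrable hl hr).abs
    calc ∫ t in u..w, e t ≤ |∫ t in u..w, e t| := le_abs_self _
      _ ≤ |∫ t in u..w, (|e t|)| := by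
          simpa only [Real.norm_eq_abs] using
            intervalIntegral.norm_integral_le_abs_integral_norm (f := e) (a := u) (b := w)
              (μ := volume)
      _ ≤ |∫ t in l..r, (|e t|)| := by
          refine intervalIntegral.abs_integral_mono_interval ?_
            (Filter.Eventually.of_forall fun _ => abs_nonneg _) habs
          rw [uIoc_of_le hlr]
          exact Ioc_subset_Ioc (le_min hu.1 hw.1) (max_le hu.2 hw.2)
      _ = ∫ t in l..r, |e t| := abs_of_nonneg (intervalIntegral.integral_nonneg hlr
          fun _ _ => abs_nonneg _)
  · have hd : 0 ≤ E w - E u := sub_nonneg.2 (hum hw)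
    rcases le_total z x with hzx | hzx
    · have h1 := hrel z x hz.1.le hzx hx.2
      have h2 := hEint z x hz.1.le hzx hx.2
      have h3 := hslope z x hz.1.le hzx hx.2
      rw [h.isPrimitive.integral_eq (hsub ⟨hz.1.le, hz.2.le⟩) (hsub hx)] at h3
      rw [hcz, mul_zero] at h1
      have : (x - z) * (E w - E u) ≤ (r - l) * (E w - E u) :=
        mul_le_mul_of_nonneg_right (by linarith [hx.2, hz.1]) hd
      linarith
    · have h1 := hrel x z hx.1 hzx hz.2.le
      have h2 := hEint x z hx.1 hzx hz.2.le
      have h3 := hslope x z hx.1 hzx hz.2.le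
      rw [h.isPrimitive.integral_eq (hsub hx) (hsub ⟨hz.1.le, hz.2.le⟩)] at h3
      rw [hcz, mul_zero] at h1
      have : (z - x) * (E w - E u) ≤ (r - l) * (E w - E u) :=
        mul_le_mul_of_nonneg_right (by linarith [hx.1, hz.2]) hd
      linarith

/-- On an interval the averages of the residual vary by at most the variation of `E`, and where they
do vary the gap is small. -/
theorem secant_bounds (h : ObstacleVI β G c E e) {l r : ℝ} (hl : l ∈ Ibar)
    (hr : r ∈ Ibar) (hlr : l < r) :
    ∃ lo hi : ℝ, lo ≤ hi ∧ hi - lo ≤ ∫ t in l..r, |e t| ∧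
      (∀ a b, l ≤ a → a ≤ b → b ≤ r → lo * (b - a) ≤ ∫ t in a..b, G t ∧
        ∫ t in a..b, G t ≤ hi * (b - a)) ∧
      ∀ x ∈ Icc l r, β * c x * (hi - lo) ≤ (r - l) * (hi - lo) ^ 2 := by
  have hsub : Icc l r ⊆ Ibar := Icc_subset_Icc hl.1 hr.2
  by_cases hex : ∃ z ∈ Ioo l r, c z = 0
  -- The gap estimate carries the extra factor hi - lo so that it also holds without contact, where
  -- hi = lo and the gap may be large.
  · obtain ⟨z, hz, hcz⟩ := hex
    obtain ⟨lo, hi, h1, h2, h3, h4⟩ := h.secant_bounds_of_contact hl hr hz hcz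
    refine ⟨lo, hi, h1, h2, h3, fun x hx => ?_⟩
    nlinarith [h4 x hx]
  · push Not at hex
    have hpos : ∀ x ∈ Ioo l r, 0 < c x := fun x hx =>
      lt_of_le_of_ne (h.gap_nonneg x (hsub (Ioo_subset_Icc_self hx))) (hex x hx).symm
    set s := (∫ t in l..r, G t) / (r - l) with hs
    have hs' : s * (r - l) = (∫ t in (-1)..r, G t) - ∫ t in (-1)..l, G t := by
      rw [hs, div_mul_cancel₀ _ (by linarith), h.isPrimitive.integral_eq hl hr]
    have hval : ∀ x ∈ Icc l r, ∫ t in (-1)..x, G t = (∫ t in (-1)..l, G t) + s * (x - l) := by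
      intro x hx
      rcases hx.1.eq_or_lt with rfl | h1
      · simp
      rcases hx.2.eq_or_lt with rfl | h2
      · linarith
      have h3 := h.affine_of_gap_pos hl hr ⟨h1, h2⟩ hpos
      have h4 : (r - l) * ((∫ t in (-1)..x, G t) - ((∫ t in (-1)..l, G t) + s * (x - l))) = 0 := by
        linear_combination h3 - (x - l) * hs'
      rcases mul_eq_zero.1 h4 with h5 | h5 <;> linarith
    refine ⟨s, s, le_rfl, ?_, fun a b ha hab hb => ?_, fun x hx => by simp⟩
    · rw [sub_self]
      exact intervalIntegral.integral_nonneg hlr.le fun _ _ => abs_nonneg _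
    · have haI : a ∈ Icc l r := ⟨ha, hab.trans hb⟩
      have hbI : b ∈ Icc l r := ⟨ha.trans hab, hb⟩
      rw [h.isPrimitive.integral_eq (hsub haI) (hsub hbI), hval a haI, hval b hbI]
      constructor <;> linarith

/-- This controls the boundary term at -1 in the summation by parts. Either factor may be large, but
not both: if c(-1) > 0, then ∫ G vanishes up to the first contact point. When that point lies before
d, this forces lo ≤ 0, hence hi ≤ hi - lo, and both factors are at most (d + 1) ∫|e|. -/
theorem left_gap_mul_le (h : ObstacleVI β G c E e) {d : ℝ} (hd : d ∈ Ibar) :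
    β * c (-1) * ∫ t in (-1)..d, G t ≤ ((d + 1) * ∫ t in (-1)..d, |e t|) ^ 2 := by
  by_cases hex : ∀ x ∈ Ico (-1) d, 0 < c x
  · rw [h.integral_eq_zero_of_gap_pos hd hex, mul_zero]
    positivity
  rcases (h.gap_nonneg (-1) neg_one_mem_Ibar).eq_or_lt with h0 | h0
  · rw [← h0, mul_zero, zero_mul]
    positivity
  push Not at hex
  obtain ⟨z, hz, hcz⟩ := hex
  have hzI : z ∈ Ibar := ⟨hz.1, by linarith [hz.2, hd.2]⟩
  have hcz : c z = 0 := le_antisymm hcz (h.gap_nonneg z hzI)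
  have hz1 : -1 < z := lt_of_le_of_ne hz.1 fun h1 => by rw [h1, hcz] at h0; exact lt_irrefl _ h0
  obtain ⟨lo, hi, h1, h2, h3, h4⟩ :=
    h.secant_bounds_of_contact neg_one_mem_Ibar hd ⟨hz1, hz.2⟩ hcz
  have hlo : lo ≤ 0 := by
    have hcpt : IsCompact (Icc (-1) z ∩ c ⁻¹' {0}) :=
      isCompact_Icc.of_isClosed_subset
        ((h.gap_cont.mono (Icc_subset_Icc_right hzI.2)).preimage_isClosed_of_isClosed isClosed_Icc
          isClosed_singleton) inter_subset_left
    obtain ⟨w, ⟨hw, hcw⟩, hwm⟩ := hcpt.exists_isLeast ⟨z, ⟨hz.1, le_rfl⟩, hcz⟩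
    have hcw : c w = 0 := hcw
    have hw1 : -1 < w := lt_of_le_of_ne hw.1 fun h1 => by
      rw [h1, hcw] at h0; exact lt_irrefl _ h0
    have hwI : w ∈ Ibar := ⟨hw.1, hw.2.trans hzI.2⟩
    have hzero := h.integral_eq_zero_of_gap_pos hwI fun x hx => by
      refine lt_of_le_of_ne (h.gap_nonneg x ⟨hx.1, hx.2.le.trans hwI.2⟩) fun h5 => ?_
      exact absurd (hwm ⟨⟨hx.1, hx.2.le.trans hw.2⟩, h5.symm⟩) (not_le.2 hx.2)
    have := (h3 (-1) w le_rfl hw.1 (hw.2.trans hz.2.le)).1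
    rw [hzero] at this
    by_contra hcon
    nlinarith [mul_pos (not_le.1 hcon) (by linarith : 0 < w - -1)]
  have hd1 : 0 ≤ d + 1 := by linarith [hd.1]
  have hb1 : β * c (-1) ≤ (d + 1) * ∫ t in (-1)..d, |e t| := by
    have := h4 (-1) ⟨le_rfl, hd.1⟩
    nlinarith
  have hb2 : ∫ t in (-1)..d, G t ≤ (d + 1) * ∫ t in (-1)..d, |e t| := by
    have := (h3 (-1) d le_rfl hd.1 le_rfl).2
    nlinarith
  rw [sq]
  exact mul_le_mul hb1 hb2 (h.integral_nonneg hd) (by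
    have : 0 ≤ β * c (-1) := mul_nonneg h.pos.le h0.le
    linarith)

end ObstacleVI

/-! ### Cauchy-Schwarz, the Hilbert space L_2(I), and bounds from averages -/

theorem memL2_abs {m : ℝ → ℝ} (hm : MemL2 m) : MemL2 (fun t => |m t|) := MemLp.abs hm

theorem MemL2.sq {m : ℝ → ℝ} (hm : MemL2 m) :
    IntervalIntegrable (fun t => m t ^ 2) volume (-1) 1 := by
  simpa only [pow_two] using hm.mul hm

/-- The Cauchy-Schwarz inequality against the constant function on an interval. -/
theorem sq_integral_abs_le {m : ℝ → ℝ} (hm : MemL2 m) {a b : ℝ} (ha : a ∈ Ibar) (hb : b ∈ Ibar)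
    (hab : a ≤ b) : (∫ t in a..b, |m t|) ^ 2 ≤ (b - a) * ∫ t in a..b, m t ^ 2 := by
  rcases hab.eq_or_lt with rfl | hlt
  · simp
  have h1 : IntervalIntegrable (fun t => |m t|) volume a b :=
    intervalIntegrable_mono (memL2_abs hm).intervalIntegrable ha hb
  have h2 : IntervalIntegrable (fun t => m t ^ 2) volume a b :=
    intervalIntegrable_mono hm.sq ha hb
  have hb0 : 0 < b - a := sub_pos.2 hlt
  set A := ∫ t in a..b, |m t| with hA
  -- This integral is b - a times the difference of the two sides of the claim.
  have key : 0 ≤ ∫ t in a..b, ((b - a) * |m t| - A) ^ 2 :=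
    intervalIntegral.integral_nonneg hab fun _ _ => sq_nonneg _
  have e1 : ∫ t in a..b, ((b - a) * |m t| - A) ^ 2 =
      (b - a) ^ 2 * (∫ t in a..b, m t ^ 2) - (2 * A * (b - a)) * A + (b - a) * A ^ 2 := by
    have : ∫ t in a..b, ((b - a) * |m t| - A) ^ 2 =
        ∫ t in a..b, (((b - a) ^ 2 * m t ^ 2 - (2 * A * (b - a)) * |m t|) + A ^ 2) := by
      refine intervalIntegral.integral_congr fun t _ => ?_
      have := sq_abs (m t)
      linear_combination (b - a) ^ 2 * this
    rw [this, intervalIntegral.integral_add ((h2.const_mul _).sub (h1.const_mul _)) (by simp),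
      intervalIntegral.integral_sub (h2.const_mul _) (h1.const_mul _),
      intervalIntegral.integral_const_mul, intervalIntegral.integral_const_mul,
      intervalIntegral.integral_const, smul_eq_mul]
  rw [e1] at key
  have : 0 ≤ (b - a) * ((b - a) * (∫ t in a..b, m t ^ 2) - A ^ 2) := by linarith
  have := nonneg_of_mul_nonneg_right this hb0
  linarith

/-- The Hilbert space `L_2(I)`. -/
noncomputable abbrev L2I := Lp ℝ 2 (volume.restrict I)

/-- The class of a square integrable function. -/
noncomputable def toL2 (u : ℝ → ℝ) (hu : MemL2 u) : L2I := MemLp.toLp u hu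

theorem coe_toL2 {u : ℝ → ℝ} (hu : MemL2 u) : toL2 u hu =ᵐ[volume.restrict I] u :=
  MemLp.coeFn_toLp hu

theorem toL2_congr {u v : ℝ → ℝ} (hu : MemL2 u) (hv : MemL2 v) (h : u =ᵐ[volume.restrict I] v) :
    toL2 u hu = toL2 v hv :=
  MemLp.toLp_congr hu hv h

theorem toL2_add {u v : ℝ → ℝ} (hu : MemL2 u) (hv : MemL2 v) :
    toL2 (fun x => u x + v x) (hu.add hv) = toL2 u hu + toL2 v hv :=
  MemLp.toLp_add hu hv

theorem toL2_sub {u v : ℝ → ℝ} (hu : MemL2 u) (hv : MemL2 v) :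
    toL2 (fun x => u x - v x) (hu.sub hv) = toL2 u hu - toL2 v hv :=
  MemLp.toLp_sub hu hv

theorem toL2_const_mul {u : ℝ → ℝ} (c : ℝ) (hu : MemL2 u) :
    toL2 (fun x => c * u x) (hu.const_mul c) = c • toL2 u hu :=
  MemLp.toLp_const_smul c hu

theorem memL2_coe (g : L2I) : MemL2 g := Lp.memLp g

theorem toL2_coe (g : L2I) : toL2 g (memL2_coe g) = g := Lp.toLp_coeFn g (memL2_coe g)

theorem inner_toL2_eq {u v : ℝ → ℝ} (hu : MemL2 u) (hv : MemL2 v) :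
    inner ℝ (toL2 u hu) (toL2 v hv) = ∫ t in (-1)..1, u t * v t := by
  rw [← integral_I, L2.inner_def]
  refine integral_congr_ae ?_
  filter_upwards [coe_toL2 hu, coe_toL2 hv] with t h1 h2
  simp [h1, h2, mul_comm]

theorem norm_toL2_eq {w : ℝ → ℝ} (hw : MemL2 w) :
    ‖toL2 w hw‖ = Real.sqrt (∫ t in (-1)..1, w t ^ 2) := by
  rw [norm_eq_sqrt_real_inner, inner_toL2_eq]
  simp only [pow_two]

/-- The Cauchy-Schwarz inequality in `L_2(I)`. -/
theorem integral_mul_le_sqrt {u v : ℝ → ℝ} (hu : MemL2 u) (hv : MemL2 v) :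
    ∫ t in (-1)..1, u t * v t ≤
      Real.sqrt (∫ t in (-1)..1, u t ^ 2) * Real.sqrt (∫ t in (-1)..1, v t ^ 2) := by
  rw [← inner_toL2_eq hu hv, ← norm_toL2_eq hu, ← norm_toL2_eq hv]
  exact real_inner_le_norm _ _

/-- Bounds for all averages of a function are bounds for the function. -/
theorem ae_bounds_of_secant_bounds {φ : ℝ → ℝ} {l r lo hi : ℝ}
    (hφ : IntervalIntegrable φ volume l r)
    (h : ∀ a b, l ≤ a → a ≤ b → b ≤ r → lo * (b - a) ≤ ∫ t in a..b, φ t ∧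
      ∫ t in a..b, φ t ≤ hi * (b - a)) :
    ∀ᵐ t, t ∈ Ioc l r → lo ≤ φ t ∧ φ t ≤ hi := by
  have h1 : ∀ᵐ x : ℝ, x ≠ r := by simp [ae_iff, measure_singleton]
  filter_upwards [hφ.ae_hasDerivAt_integral, h1] with x hx hxr hxI
  have hlr : l ≤ r := hxI.1.le.trans hxI.2
  have hd := hx (by rw [uIcc_of_le hlr]; exact Ioc_subset_Icc_self hxI) l left_mem_uIcc
  rw [hasDerivAt_iff_tendsto_slope] at hd
  -- Difference quotients from the right suffice; excluding x = r leaves room for them.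
  have hd' := hd.mono_left (nhdsWithin_mono x (fun y hy => ne_of_gt hy : Ioi x ⊆ {x}ᶜ))
  have hev : ∀ᶠ y in nhdsWithin x (Ioi x), y ∈ Ioo x r :=
    Ioo_mem_nhdsGT (lt_of_le_of_ne hxI.2 hxr)
  have hsl : ∀ y ∈ Ioo x r, slope (fun x => ∫ t in l..x, φ t) x y =
      (∫ t in x..y, φ t) / (y - x) := by
    intro y hy
    rw [slope_def_field, intervalIntegral.integral_interval_sub_left]
    · exact hφ.mono_set (uIcc_subset_uIcc left_mem_uIcc
        (by rw [uIcc_of_le hlr]; exact ⟨by linarith [hy.1, hxI.1], hy.2.le⟩))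
    · exact hφ.mono_set (uIcc_subset_uIcc left_mem_uIcc
        (by rw [uIcc_of_le hlr]; exact Ioc_subset_Icc_self hxI))
  constructor
  · refine ge_of_tendsto hd' ?_
    filter_upwards [hev] with y hy
    rw [hsl y hy, le_div_iff₀ (by linarith [hy.1])]
    exact (h x y hxI.1.le hy.1.le hy.2.le).1
  · refine le_of_tendsto hd' ?_
    filter_upwards [hev] with y hy
    rw [hsl y hy, div_le_iff₀ (by linarith [hy.1])]
    exact (h x y hxI.1.le hy.1.le hy.2.le).2

/-! ### Element averages and the projected residual -/

/-- The points `x 0 < ⋯ < x n` partition `[-1,1]` into elements of length at most `H`. -/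
structure IsNodes (n : ℕ) (x : ℕ → ℝ) (H : ℝ) : Prop where
  first : x 0 = -1
  last : x n = 1
  lt : ∀ i < n, x i < x (i + 1)
  le : ∀ i < n, x (i + 1) - x i ≤ H

/-- The average of `φ` over the `i`-th element. -/
noncomputable def avg (x : ℕ → ℝ) (φ : ℝ → ℝ) (i : ℕ) : ℝ :=
  (∫ t in x i..x (i + 1), φ t) / (x (i + 1) - x i)

/-- The piecewise constant function of the element averages of `φ`. -/
noncomputable def stepMean (n : ℕ) (x : ℕ → ℝ) (φ : ℝ → ℝ) (t : ℝ) : ℝ :=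
  ∑ i ∈ Finset.range n, indicator (Ioc (x i) (x (i + 1))) (fun _ => avg x φ i) t

theorem memL2_stepMean (n : ℕ) (x : ℕ → ℝ) (φ : ℝ → ℝ) : MemL2 (stepMean n x φ) := by
  refine memLp_finsetSum (Finset.range n) fun i _ => ?_
  refine MemLp.of_bound (C := |avg x φ i|) ?_ (Filter.Eventually.of_forall fun t => ?_)
  · exact (measurable_const.indicator measurableSet_Ioc).aestronglyMeasurable
  · by_cases h : t ∈ Ioc (x i) (x (i + 1))
    · rw [indicator_of_mem h, Real.norm_eq_abs]
    · rw [indicator_of_notMem h, norm_zero]; exact abs_nonneg _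

namespace IsNodes

variable {n : ℕ} {x : ℕ → ℝ} {H : ℝ}

theorem mono (h : IsNodes n x H) {i j : ℕ} (hij : i ≤ j) (hj : j ≤ n) : x i ≤ x j := by
  induction j, hij using Nat.le_induction with
  | base => exact le_rfl
  | succ j _ ih => exact (ih (by omega)).trans (h.lt j (by omega)).le

theorem mem (h : IsNodes n x H) {i : ℕ} (hi : i ≤ n) : x i ∈ Ibar :=
  ⟨h.first ▸ h.mono (Nat.zero_le i) hi, h.last ▸ h.mono hi le_rfl⟩

theorem pos (h : IsNodes n x H) : 0 < n := by
  rcases Nat.eq_zero_or_pos n with h0 | h0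
  · have h1 := h.first
    have h2 := h.last
    rw [h0, h1] at h2
    norm_num at h2
  · exact h0

theorem H_pos (h : IsNodes n x H) : 0 < H := by
  linarith [h.lt 0 h.pos, h.le 0 h.pos]

theorem sum_integral (h : IsNodes n x H) {g : ℝ → ℝ} (hg : IntervalIntegrable g volume (-1) 1) :
    ∑ i ∈ Finset.range n, ∫ t in x i..x (i + 1), g t = ∫ t in (-1)..1, g t := by
  rw [intervalIntegral.sum_integral_adjacent_intervals, h.first, h.last]
  exact fun i hi => intervalIntegrable_mono hg (h.mem hi.le) (h.mem hi)

theorem stepMean_eq (h : IsNodes n x H) (φ : ℝ → ℝ) {i : ℕ} (hi : i < n) {t : ℝ}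
    (ht : t ∈ Ioc (x i) (x (i + 1))) : stepMean n x φ t = avg x φ i := by
  unfold stepMean
  rw [Finset.sum_eq_single_of_mem i (Finset.mem_range.2 hi), indicator_of_mem ht]
  intro j hj hji
  refine indicator_of_notMem (fun htj => ?_) _
  have hj := Finset.mem_range.1 hj
  rcases lt_or_gt_of_ne hji with hlt | hlt
  · have := h.mono (Nat.succ_le_of_lt hlt) hi.le
    linarith [htj.2, ht.1]
  · have := h.mono (Nat.succ_le_of_lt hlt) hj.le
    linarith [htj.1, ht.2]

theorem avg_mul (h : IsNodes n x H) (φ : ℝ → ℝ) {i : ℕ} (hi : i < n) :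
    avg x φ i * (x (i + 1) - x i) = ∫ t in x i..x (i + 1), φ t :=
  div_mul_cancel₀ _ (by linarith [h.lt i hi])

theorem integral_congr_element (h : IsNodes n x H) {i : ℕ} (hi : i < n) {g k : ℝ → ℝ}
    (hgk : ∀ t ∈ Ioc (x i) (x (i + 1)), g t = k t) :
    ∫ t in x i..x (i + 1), g t = ∫ t in x i..x (i + 1), k t := by
  refine intervalIntegral.integral_congr_ae (Filter.Eventually.of_forall fun t ht => hgk t ?_)
  rwa [uIoc_of_le (h.lt i hi).le] at ht

theorem integral_stepMean_element (h : IsNodes n x H) (φ : ℝ → ℝ) {i : ℕ} (hi : i < n) :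
    ∫ t in x i..x (i + 1), stepMean n x φ t = ∫ t in x i..x (i + 1), φ t := by
  rw [h.integral_congr_element hi (k := fun _ => avg x φ i) fun t ht => h.stepMean_eq φ hi ht,
    intervalIntegral.integral_const, smul_eq_mul, mul_comm, h.avg_mul φ hi]

theorem integral_stepMean_tail (h : IsNodes n x H) {φ : ℝ → ℝ}
    (hφ : IntervalIntegrable φ volume (-1) 1) {i : ℕ} (hi : i ≤ n) :
    ∫ t in x i..1, stepMean n x φ t = ∫ t in x i..1, φ t := by
  have hs := (memL2_stepMean n x φ).intervalIntegrable
  have key : ∀ k : ℝ → ℝ, IntervalIntegrable k volume (-1) 1 →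
      ∑ j ∈ Finset.Ico i n, ∫ t in x j..x (j + 1), k t = ∫ t in x i..1, k t := by
    intro k hk
    rw [intervalIntegral.sum_integral_adjacent_intervals_Ico hi, h.last]
    exact fun j hj => intervalIntegrable_mono hk (h.mem hj.2.le) (h.mem hj.2)
  rw [← key _ hs, ← key _ hφ]
  exact Finset.sum_congr rfl fun j hj => h.integral_stepMean_element φ (Finset.mem_Ico.1 hj).2

/-- The approximation error of element averages. -/
theorem integral_sq_sub_stepMean_le (h : IsNodes n x H) {φ m : ℝ → ℝ} (hφ : MemL2 φ)
    (hm : MemL2 m) (hosc : ∀ i < n, ∀ᵐ t, t ∈ Ioc (x i) (x (i + 1)) →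
      |φ t - avg x φ i| ≤ ∫ s in x i..x (i + 1), |m s|) :
    ∫ t in (-1)..1, (φ t - stepMean n x φ t) ^ 2 ≤ H ^ 2 * ∫ t in (-1)..1, m t ^ 2 := by
  have hsq : IntervalIntegrable (fun t => (φ t - stepMean n x φ t) ^ 2) volume (-1) 1 :=
    (hφ.sub (memL2_stepMean n x φ)).sq
  rw [← h.sum_integral hsq, ← h.sum_integral hm.sq, Finset.mul_sum]
  refine Finset.sum_le_sum fun i hi => ?_
  have hi := Finset.mem_range.1 hi
  have hlt := h.lt i hi
  set ε := ∫ s in x i..x (i + 1), |m s| with hε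
  have hCS := sq_integral_abs_le hm (h.mem hi.le) (h.mem hi) hlt.le
  have hm0 : 0 ≤ ∫ t in x i..x (i + 1), m t ^ 2 :=
    intervalIntegral.integral_nonneg hlt.le fun _ _ => sq_nonneg _
  -- One factor of the element length comes from integrating the constant ε², the other from
  -- Cauchy-Schwarz.
  calc ∫ t in x i..x (i + 1), (φ t - stepMean n x φ t) ^ 2
      ≤ ∫ _ in x i..x (i + 1), ε ^ 2 := by
        refine intervalIntegral.integral_mono_ae_restrict hlt.le
          (intervalIntegrable_mono hsq (h.mem hi.le) (h.mem hi)) (by simp) ?_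
        rw [Filter.EventuallyLE, ae_restrict_iff' measurableSet_Icc]
        have h1 : ∀ᵐ t : ℝ, t ≠ x i := by simp [ae_iff, measure_singleton]
        filter_upwards [hosc i hi, h1] with t ht hti htI
        have htI' : t ∈ Ioc (x i) (x (i + 1)) := ⟨lt_of_le_of_ne htI.1 (Ne.symm hti), htI.2⟩
        rw [h.stepMean_eq φ hi htI', ← sq_abs]
        exact pow_le_pow_left₀ (abs_nonneg _) (ht htI') 2
    _ = (x (i + 1) - x i) * ε ^ 2 := by rw [intervalIntegral.integral_const, smul_eq_mul]
    _ ≤ (x (i + 1) - x i) * ((x (i + 1) - x i) * ∫ t in x i..x (i + 1), m t ^ 2) :=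
        mul_le_mul_of_nonneg_left hCS (by linarith)
    _ ≤ H ^ 2 * ∫ t in x i..x (i + 1), m t ^ 2 := by
        rw [← mul_assoc, ← sq]
        exact mul_le_mul_of_nonneg_right
          (pow_le_pow_left₀ (by linarith) (h.le i hi) 2) hm0

theorem abs_sub_avg_le_of_secant_bounds (h : IsNodes n x H) {φ : ℝ → ℝ} {lo hi ε : ℝ} {i : ℕ}
    (hi' : i < n) (hφ : IntervalIntegrable φ volume (-1) 1) (hε : hi - lo ≤ ε)
    (hb : ∀ a b, x i ≤ a → a ≤ b → b ≤ x (i + 1) → lo * (b - a) ≤ ∫ t in a..b, φ t ∧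
      ∫ t in a..b, φ t ≤ hi * (b - a)) :
    ∀ᵐ t, t ∈ Ioc (x i) (x (i + 1)) → |φ t - avg x φ i| ≤ ε := by
  have hlt := h.lt i hi'
  have h1 := hb (x i) (x (i + 1)) le_rfl hlt.le le_rfl
  rw [← h.avg_mul φ hi'] at h1
  have h2 := le_of_mul_le_mul_right h1.1 (sub_pos.2 hlt)
  have h3 := le_of_mul_le_mul_right h1.2 (sub_pos.2 hlt)
  filter_upwards [ae_bounds_of_secant_bounds
    (intervalIntegrable_mono hφ (h.mem hi'.le) (h.mem hi')) hb] with t ht htI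
  have h4 := ht htI
  rw [abs_le]
  constructor <;> linarith [h4.1, h4.2]

/-- The oscillation of a primitive on an element. -/
theorem abs_sub_avg_le_of_isPrimitive (h : IsNodes n x H) {F φ : ℝ → ℝ} (hF : IsPrimitive F φ)
    {i : ℕ} (hi : i < n) {t : ℝ} (ht : t ∈ Ioc (x i) (x (i + 1))) :
    |F t - avg x F i| ≤ ∫ s in x i..x (i + 1), |φ s| := by
  have hlt := h.lt i hi
  have hsub : Icc (x i) (x (i + 1)) ⊆ Ibar := Icc_subset_Icc (h.mem hi.le).1 (h.mem hi).2
  set ε := ∫ s in x i..x (i + 1), |φ s| with hε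
  have htI := Ioc_subset_Icc_self ht
  have habs : IntervalIntegrable (fun t => |φ t|) volume (x i) (x (i + 1)) :=
    (intervalIntegrable_mono hF.integrable (h.mem hi.le) (h.mem hi)).abs
  have hdiff : ∀ s ∈ Icc (x i) (x (i + 1)), |F t - F s| ≤ ε := by
    intro s hs
    rw [← hF.integral_eq (hsub hs) (hsub htI)]
    calc |∫ t in s..t, φ t| ≤ |∫ t in s..t, (|φ t|)| := by
          simpa only [Real.norm_eq_abs] using
            intervalIntegral.norm_integral_le_abs_integral_norm (f := φ) (a := s) (b := t)
              (μ := volume)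
      _ ≤ |∫ t in x i..x (i + 1), (|φ t|)| := by
          refine intervalIntegral.abs_integral_mono_interval ?_
            (Filter.Eventually.of_forall fun _ => abs_nonneg _) habs
          rw [uIoc_of_le hlt.le]
          exact Ioc_subset_Ioc (le_min hs.1 htI.1) (max_le hs.2 htI.2)
      _ = ε := abs_of_nonneg (intervalIntegral.integral_nonneg hlt.le
          fun _ _ => abs_nonneg _)
  have hFi : IntervalIntegrable F volume (x i) (x (i + 1)) := by
    apply ContinuousOn.intervalIntegrable
    rw [uIcc_of_le hlt.le]
    exact hF.continuousOn.mono hsub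
  have h1 := intervalIntegral.integral_mono_on hlt.le hFi
    (intervalIntegrable_const (c := F t + ε)) fun s hs => by
      linarith [(abs_le.1 (hdiff s hs)).1]
  have h2 := intervalIntegral.integral_mono_on hlt.le (intervalIntegrable_const (c := F t - ε))
    hFi fun s hs => by linarith [(abs_le.1 (hdiff s hs)).2]
  rw [intervalIntegral.integral_const, smul_eq_mul, ← h.avg_mul F hi, mul_comm] at h1 h2
  have hp := sub_pos.2 hlt
  have h3 := le_of_mul_le_mul_left h1 hp
  have h4 := le_of_mul_le_mul_left (by linarith : (x (i + 1) - x i) * (F t - ε) ≤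
    (x (i + 1) - x i) * avg x F i) hp
  rw [abs_le]
  constructor <;> linarith

/-- The sum that remains of the residual after projection onto piecewise constants. -/
theorem sum_avg_mul_le (h : IsNodes n x H) {β : ℝ} {G c E e : ℝ → ℝ}
    (ho : ObstacleVI β G c E e) (he : MemL2 e) {q : ℕ → ℝ} (hqn : q n = 0)
    (hq : ∀ i < n, -c (x i) ≤ q i) :
    β * ∑ i ∈ Finset.range n, avg x G i * (q (i + 1) - q i) ≤
      9 * H ^ 2 * ∫ t in (-1)..1, e t ^ 2 := by
  -- The interior nodes are then x 1, ..., x N, one for each term of the Abel sum.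
  obtain ⟨N, rfl⟩ : ∃ N, n = N + 1 := ⟨n - 1, by have := h.pos; omega⟩
  set M := ∫ t in (-1)..1, e t ^ 2 with hM
  have hH := h.H_pos
  -- Summation by parts moves the differences from q to the means of G.
  have habel : ∀ N : ℕ, ∑ i ∈ Finset.range (N + 1), avg x G i * (q (i + 1) - q i) =
      avg x G N * q (N + 1) - avg x G 0 * q 0
        - ∑ i ∈ Finset.range N, q (i + 1) * (avg x G (i + 1) - avg x G i) := by
    intro N
    induction N with
    | zero => simp; ring
    | succ N ih => rw [Finset.sum_range_succ, ih, Finset.sum_range_succ _ N]; ring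
  have hI : ∀ i < N + 1, 0 ≤ ∫ t in x i..x (i + 1), e t ^ 2 := fun i hi =>
    intervalIntegral.integral_nonneg (h.lt i hi).le fun _ _ => sq_nonneg _
  have hsum := h.sum_integral he.sq
  -- The first mean is nonnegative, so -q 0 may be replaced by the gap c(-1).
  have hfirst : β * (-(avg x G 0 * q 0)) ≤ H ^ 2 * M := by
    have h0 := h.pos
    have hlt := h.lt 0 h0
    have hle := h.le 0 h0
    have h1 := ho.left_gap_mul_le (h.mem (show 1 ≤ N + 1 by omega))
    have hA := h.avg_mul G h0
    have hA0 := ho.integral_nonneg (h.mem (show 1 ≤ N + 1 by omega))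
    have hCS := sq_integral_abs_le he (h.mem h0.le) (h.mem h0) hlt.le
    simp only [zero_add] at hA hlt hle hCS
    have hx0 := h.first
    rw [hx0] at hA hlt hle hCS
    rw [sub_neg_eq_add] at hA hle hCS
    rw [← hA] at h1 hA0
    have hpos : 0 < x 1 + 1 := by linarith
    have hA0' : 0 ≤ avg x G 0 := nonneg_of_mul_nonneg_left hA0 hpos
    have h2 : (β * c (-1) * avg x G 0) * (x 1 + 1) ≤
        ((x 1 + 1) * ((x 1 + 1) * ∫ t in (-1)..x 1, e t ^ 2)) * (x 1 + 1) := by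
      calc _ = β * c (-1) * (avg x G 0 * (x 1 + 1)) := by ring
        _ ≤ _ := h1
        _ = (x 1 + 1) ^ 2 * (∫ t in (-1)..x 1, |e t|) ^ 2 := by ring
        _ ≤ (x 1 + 1) ^ 2 * ((x 1 + 1) * ∫ t in (-1)..x 1, e t ^ 2) :=
            mul_le_mul_of_nonneg_left hCS (sq_nonneg _)
        _ = _ := by ring
    have h3 := le_of_mul_le_mul_right h2 hpos
    have h4 : ∫ t in (-1)..x 1, e t ^ 2 ≤ M := by
      have := Finset.single_le_sum (fun i hi => hI i (Finset.mem_range.1 hi))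
        (Finset.mem_range.2 h0)
      simp only [zero_add, hx0] at this
      rwa [hsum] at this
    have h40 := hI 0 h0
    simp only [zero_add, hx0] at h40
    have h5 := hq 0 h0
    rw [hx0] at h5
    calc β * (-(avg x G 0 * q 0)) = β * avg x G 0 * (-q 0) := by ring
      _ ≤ β * avg x G 0 * c (-1) :=
          mul_le_mul_of_nonneg_left (by linarith) (mul_nonneg ho.pos.le hA0')
      _ = β * c (-1) * avg x G 0 := by ring
      _ ≤ _ := h3
      _ = (x 1 + 1) ^ 2 * ∫ t in (-1)..x 1, e t ^ 2 := by ring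
      _ ≤ H ^ 2 * M := mul_le_mul (pow_le_pow_left₀ hpos.le hle 2) h4 h40 (by positivity)
  -- By convexity the jump of the means at the node x (i + 1) is nonnegative, so -q may be replaced
  -- by the gap. The secant bounds are used on the union of the two adjacent elements; its length is
  -- at most 2H, whence the factor 4.
  have hterm : ∀ i ∈ Finset.range N, β * (-(q (i + 1) * (avg x G (i + 1) - avg x G i))) ≤
      4 * H ^ 2 * ((∫ t in x i..x (i + 1), e t ^ 2) +
        ∫ t in x (i + 1)..x (i + 2), e t ^ 2) := by
    intro i hi
    have hi := Finset.mem_range.1 hi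
    have hi1 : i + 1 < N + 1 := by omega
    have hi0 : i < N + 1 := by omega
    have hl1 := h.lt i hi0
    have hl2 := h.lt (i + 1) hi1
    have hm0 := h.mem hi0.le
    have hm1 := h.mem hi1.le
    have hm2 := h.mem (show i + 2 ≤ N + 1 by omega)
    obtain ⟨lo, hi', hlh, hε, hs, hg⟩ := ho.secant_bounds hm0 hm2 (hl1.trans hl2)
    have hA := h.avg_mul G hi0
    have hB := h.avg_mul G hi1
    have hA1 := (hs (x i) (x (i + 1)) le_rfl hl1.le hl2.le).1
    have hB1 := (hs (x (i + 1)) (x (i + 2)) hl1.le hl2.le le_rfl).2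
    have hAB := ho.convexOn.slope_mono_adjacent hm0 hm2 hl1 hl2
    rw [← hA] at hA1
    rw [show i + 1 + 1 = i + 2 from rfl] at hB
    rw [← hB] at hB1
    have hA2 := le_of_mul_le_mul_right hA1 (sub_pos.2 hl1)
    have hB2 := le_of_mul_le_mul_right hB1 (sub_pos.2 hl2)
    rw [← ho.isPrimitive.integral_eq hm0 hm1, ← ho.isPrimitive.integral_eq hm1 hm2] at hAB
    have hAB : avg x G i ≤ avg x G (i + 1) := hAB
    have hc := hg (x (i + 1)) ⟨hl1.le, hl2.le⟩
    have hCS := sq_integral_abs_le he hm0 hm2 (hl1.trans hl2).le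
    have hsplit := intervalIntegral.integral_add_adjacent_intervals
      (intervalIntegrable_mono he.sq hm0 hm1) (intervalIntegrable_mono he.sq hm1 hm2)
    rw [hsplit]
    have hlen : x (i + 2) - x i ≤ 2 * H := by
      have := h.le i hi0
      have h2 := h.le (i + 1) hi1
      rw [show i + 1 + 1 = i + 2 from rfl] at h2
      linarith
    have hlen0 : 0 ≤ x (i + 2) - x i := by linarith
    have hJ : 0 ≤ ∫ t in x i..x (i + 2), e t ^ 2 :=
      intervalIntegral.integral_nonneg (by linarith) fun _ _ => sq_nonneg _
    have hβc : 0 ≤ β * c (x (i + 1)) := mul_nonneg ho.pos.le (ho.gap_nonneg _ hm1)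
    calc β * (-(q (i + 1) * (avg x G (i + 1) - avg x G i)))
        = β * (avg x G (i + 1) - avg x G i) * (-q (i + 1)) := by ring
      _ ≤ β * (avg x G (i + 1) - avg x G i) * c (x (i + 1)) :=
          mul_le_mul_of_nonneg_left (by linarith [hq (i + 1) hi1])
            (mul_nonneg ho.pos.le (by linarith))
      _ = β * c (x (i + 1)) * (avg x G (i + 1) - avg x G i) := by ring
      _ ≤ β * c (x (i + 1)) * (hi' - lo) := mul_le_mul_of_nonneg_left (by linarith) hβc
      _ ≤ (x (i + 2) - x i) * (hi' - lo) ^ 2 := hc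
      _ ≤ (x (i + 2) - x i) * (∫ t in x i..x (i + 2), |e t|) ^ 2 :=
          mul_le_mul_of_nonneg_left (pow_le_pow_left₀ (by linarith) hε 2) hlen0
      _ ≤ (x (i + 2) - x i) * ((x (i + 2) - x i) * ∫ t in x i..x (i + 2), e t ^ 2) :=
          mul_le_mul_of_nonneg_left hCS hlen0
      _ = (x (i + 2) - x i) ^ 2 * ∫ t in x i..x (i + 2), e t ^ 2 := by ring
      _ ≤ (2 * H) ^ 2 * ∫ t in x i..x (i + 2), e t ^ 2 :=
          mul_le_mul_of_nonneg_right (pow_le_pow_left₀ hlen0 hlen 2) hJ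
      _ = _ := by ring
  have hrest := Finset.sum_le_sum hterm
  rw [← Finset.mul_sum, ← Finset.mul_sum, Finset.sum_neg_distrib, Finset.sum_add_distrib] at hrest
  have hS1 : ∑ i ∈ Finset.range N, (∫ t in x i..x (i + 1), e t ^ 2) ≤ M := by
    rw [hM, ← hsum, Finset.sum_range_succ]
    linarith [hI N (by omega)]
  have hS2 : ∑ i ∈ Finset.range N, (∫ t in x (i + 1)..x (i + 2), e t ^ 2) ≤ M := by
    rw [hM, ← hsum, Finset.sum_range_succ']
    linarith [hI 0 (by omega)]
  rw [habel, hqn]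
  -- Each of the two sums over neighbouring elements is at most M; with the boundary term the
  -- constant is 1 + 4 + 4 = 9.
  have : 4 * H ^ 2 * (∑ i ∈ Finset.range N, (∫ t in x i..x (i + 1), e t ^ 2) +
      ∑ i ∈ Finset.range N, (∫ t in x (i + 1)..x (i + 2), e t ^ 2)) ≤ 4 * H ^ 2 * (M + M) :=
    mul_le_mul_of_nonneg_left (by linarith) (by positivity)
  linarith

/-- The residual tested with a direction that is admissible at the nodes. -/
theorem residual_le (h : IsNodes n x H) {β : ℝ} {G c E e r : ℝ → ℝ}
    (ho : ObstacleVI β G c E e) (he : MemL2 e) (hr : MemL2 r)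
    (hq : ∀ i < n, ∫ t in x i..1, r t ≤ c (x i)) :
    ∫ t in (-1)..1, G t * r t ≤
      H * Real.sqrt (∫ t in (-1)..1, e t ^ 2) * Real.sqrt (∫ t in (-1)..1, r t ^ 2)
        + 9 * H ^ 2 / β * ∫ t in (-1)..1, e t ^ 2 := by
  have hs := memL2_stepMean n x G
  -- Against the element means of G only the increments of q(x) = -∫_x^1 r matter, so admissibility
  -- of q at the nodes is enough.
  have e1 : ∫ t in (-1)..1, G t * r t =
      (∫ t in (-1)..1, (G t - stepMean n x G t) * r t) +
        ∑ i ∈ Finset.range n, avg x G i *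
          ((-∫ t in x (i + 1)..1, r t) - (-∫ t in x i..1, r t)) := by
    have h1 : ∫ t in (-1)..1, G t * r t = (∫ t in (-1)..1, (G t - stepMean n x G t) * r t) +
        ∫ t in (-1)..1, stepMean n x G t * r t := by
      rw [← intervalIntegral.integral_add ((ho.memL2.sub hs).mul hr) (hs.mul hr)]
      exact intervalIntegral.integral_congr fun t _ => by ring
    rw [h1, ← h.sum_integral (hs.mul hr)]
    congr 1
    refine Finset.sum_congr rfl fun i hi => ?_
    have hi := Finset.mem_range.1 hi
    rw [h.integral_congr_element hi (k := fun t => avg x G i * r t)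
      fun t ht => by rw [h.stepMean_eq G hi ht], intervalIntegral.integral_const_mul]
    congr 1
    have := intervalIntegral.integral_add_adjacent_intervals
      (intervalIntegrable_mono hr.intervalIntegrable (h.mem hi.le) (h.mem hi))
      (intervalIntegrable_mono hr.intervalIntegrable (h.mem hi) one_mem_Ibar)
    linarith
  have h2 := h.sum_avg_mul_le ho he (q := fun i => -∫ t in x i..1, r t) (by simp [h.last])
    fun i hi => neg_le_neg (hq i hi)
  have h3 := integral_mul_le_sqrt (ho.memL2.sub hs) hr
  have h4 := h.integral_sq_sub_stepMean_le ho.memL2 he fun i hi => by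
    obtain ⟨lo, hi', -, hε, hb, -⟩ := ho.secant_bounds (h.mem hi.le) (h.mem hi) (h.lt i hi)
    exact h.abs_sub_avg_le_of_secant_bounds hi ho.memL2.intervalIntegrable hε hb
  have h5 := Real.sqrt_le_sqrt h4
  rw [Real.sqrt_mul (sq_nonneg H), Real.sqrt_sq h.H_pos.le] at h5
  rw [e1]
  refine add_le_add (h3.trans (mul_le_mul_of_nonneg_right h5 (Real.sqrt_nonneg _))) ?_
  rw [div_mul_eq_mul_div, le_div_iff₀ ho.pos]
  linarith

end IsNodes

/-! ### Quadratic minimization over convex sets in a Hilbert space -/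

section Quadratic

variable {X : Type*} [NormedAddCommGroup X] [InnerProductSpace ℝ X]

/-- The reduced cost functional on a Hilbert space of second derivatives. -/
noncomputable def cost (β : ℝ) (S : X →L[ℝ] X) (a b g : X) : ℝ :=
  1 / 2 * (‖S g - a‖ ^ 2 + β * ‖g + b‖ ^ 2)

/-- The cost is half the squared distance from p = (a, -√β b) to A g = (S g, √β g) in the Hilbert
product. The second component bounds A from below, so A maps K onto a closed convex set, in which p
has a nearest point. -/
theorem exists_cost_minimizer [CompleteSpace X] {β : ℝ} (hβ : 0 < β) (S : X →L[ℝ] X) (a b : X)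
    {K : Set X} (hne : K.Nonempty) (hcl : IsClosed K) (hconv : Convex ℝ K) :
    ∃ g ∈ K, ∀ k ∈ K, cost β S a b g ≤ cost β S a b k := by
  let A : X →L[ℝ] WithLp 2 (X × X) :=
    (WithLp.prodContinuousLinearEquiv 2 ℝ X X).symm.toContinuousLinearMap ∘L
      (S.prod (Real.sqrt β • ContinuousLinearMap.id ℝ X))
  let p : WithLp 2 (X × X) := WithLp.toLp 2 (a, -(Real.sqrt β • b))
  have hs : 0 < Real.sqrt β := Real.sqrt_pos.2 hβ
  have hA : ∀ g, A g = WithLp.toLp 2 (S g, Real.sqrt β • g) := fun g => rfl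
  have hcost : ∀ g, cost β S a b g = 1 / 2 * ‖p - A g‖ ^ 2 := by
    intro g
    rw [hA, ← WithLp.toLp_sub, WithLp.prod_norm_sq_eq_of_L2, cost]
    congr 2
    · rw [norm_sub_rev]; rfl
    · have : (WithLp.toLp 2 ((a, -(Real.sqrt β • b)) - (S g, Real.sqrt β • g))).snd =
          -(Real.sqrt β • (g + b)) := by
        change -(Real.sqrt β • b) - Real.sqrt β • g = _
        rw [smul_add]
        abel
      rw [this, norm_neg, norm_smul, mul_pow, Real.norm_eq_abs, sq_abs, Real.sq_sqrt hβ.le]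
  have hanti : AntilipschitzWith (Real.toNNReal (Real.sqrt β)⁻¹) A := by
    refine AddMonoidHomClass.antilipschitz_of_bound A fun g => ?_
    rw [Real.coe_toNNReal _ (by positivity), inv_mul_eq_div, le_div_iff₀ hs, hA]
    have h1 := WithLp.prod_norm_sq_eq_of_L2 (WithLp.toLp 2 (S g, Real.sqrt β • g))
    have h2 : ‖g‖ * Real.sqrt β = ‖Real.sqrt β • g‖ := by
      rw [norm_smul, Real.norm_eq_abs, abs_of_pos hs, mul_comm]
    rw [h2]
    refine le_of_sq_le_sq ?_ (norm_nonneg _)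
    rw [h1]
    exact le_add_of_nonneg_left (sq_nonneg _)
  have hclosed : IsClosed (A '' K) :=
    (hanti.isClosedEmbedding A.uniformContinuous).isClosedMap _ hcl
  obtain ⟨_, ⟨g, hg, rfl⟩, hmin⟩ := exists_norm_eq_iInf_of_complete_convex (hne.image A)
    hclosed.isComplete (hconv.linear_image A.toLinearMap) p
  refine ⟨g, hg, fun k hk => ?_⟩
  rw [hcost, hcost, hmin]
  have hbdd : BddBelow (range fun w : A '' K => ‖p - w‖) :=
    ⟨0, by rintro _ ⟨w, rfl⟩; exact norm_nonneg _⟩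
  have h1 := ciInf_le hbdd ⟨A k, mem_image_of_mem A hk⟩
  have h0 : 0 ≤ ⨅ w : A '' K, ‖p - w‖ := Real.iInf_nonneg fun _ => norm_nonneg _
  have := pow_le_pow_left₀ h0 h1 2
  linarith

/-- Along the segment from g to k the cost is quadratic in t with linear coefficient L. Minimality
gives L + tM/2 ≥ 0 for 0 < t ≤ 1, and t tends to 0. -/
theorem cost_variational_inequality {β : ℝ} (S : X →L[ℝ] X) {a b g : X} {K : Set X}
    (hconv : Convex ℝ K) (hg : g ∈ K) (hmin : ∀ k ∈ K, cost β S a b g ≤ cost β S a b k)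
    {k : X} (hk : k ∈ K) : 0 ≤ inner ℝ (S g - a) (S (k - g)) + β * inner ℝ (g + b) (k - g) := by
  set L := inner ℝ (S g - a) (S (k - g)) + β * inner ℝ (g + b) (k - g) with hL
  set M := ‖S (k - g)‖ ^ 2 + β * ‖k - g‖ ^ 2 with hM
  have hexp : ∀ t : ℝ, cost β S a b (g + t • (k - g)) = cost β S a b g + t * L + t ^ 2 / 2 * M := by
    intro t
    have e1 : S (g + t • (k - g)) - a = (S g - a) + t • S (k - g) := by
      rw [map_add, map_smul]; abel
    have e2 : g + t • (k - g) + b = (g + b) + t • (k - g) := by abel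
    rw [cost, cost, e1, e2, norm_add_sq_real, norm_add_sq_real, norm_smul, norm_smul,
      inner_smul_right, inner_smul_right, mul_pow, mul_pow, Real.norm_eq_abs, sq_abs, hL, hM]
    ring
  have hineq : ∀ t : ℝ, 0 < t → t ≤ 1 → 0 ≤ L + t / 2 * M := by
    intro t ht ht1
    have h1 := hmin _ (hconv.add_smul_sub_mem hg hk ⟨ht.le, ht1⟩)
    rw [hexp] at h1
    have h2 : 0 ≤ t * (L + t / 2 * M) := by nlinarith
    exact nonneg_of_mul_nonneg_right h2 ht
  have htend : Filter.Tendsto (fun t : ℝ => L + t / 2 * M) (nhdsWithin 0 (Ioi 0)) (nhds L) := by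
    have : Continuous fun t : ℝ => L + t / 2 * M := by fun_prop
    simpa using (this.tendsto 0).mono_left nhdsWithin_le_nhds
  refine ge_of_tendsto htend ?_
  filter_upwards [Ioo_mem_nhdsGT (zero_lt_one' ℝ)] with t ht
  exact hineq t ht.1 ht.2.le

/-- Testing each minimizer with the other and adding yields ‖S(k - g)‖² + β‖k - g‖² ≤ 0. -/
theorem cost_minimizer_unique {β : ℝ} (hβ : 0 < β) (S : X →L[ℝ] X) {a b g k : X} {K : Set X}
    (hconv : Convex ℝ K) (hg : g ∈ K) (hmin : ∀ k ∈ K, cost β S a b g ≤ cost β S a b k)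
    (hk : k ∈ K) (hmin' : ∀ l ∈ K, cost β S a b k ≤ cost β S a b l) : k = g := by
  have h1 := cost_variational_inequality S hconv hg hmin hk
  have h2 := cost_variational_inequality S hconv hk hmin' hg
  have e1 : S (g - k) = -S (k - g) := by rw [← map_neg, neg_sub]
  have e2 : g - k = -(k - g) := (neg_sub _ _).symm
  rw [e1, e2, inner_neg_right, inner_neg_right] at h2
  have h3 : inner ℝ (S g - a) (S (k - g)) - inner ℝ (S k - a) (S (k - g)) =
      -‖S (k - g)‖ ^ 2 := by
    rw [← inner_sub_left, ← real_inner_self_eq_norm_sq, ← inner_neg_left, map_sub]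
    congr 1; abel
  have h4 : inner ℝ (g + b) (k - g) - inner ℝ (k + b) (k - g) = -‖k - g‖ ^ 2 := by
    rw [← inner_sub_left, ← real_inner_self_eq_norm_sq, ← inner_neg_left]
    congr 1; abel
  have h5 : β * ‖k - g‖ ^ 2 ≤ 0 := by nlinarith [sq_nonneg ‖S (k - g)‖]
  have h6 : ‖k - g‖ ^ 2 ≤ 0 := nonpos_of_mul_nonpos_right h5 hβ
  rw [← sub_eq_zero, ← norm_eq_zero]
  exact pow_eq_zero_iff two_ne_zero |>.1 (le_antisymm h6 (sq_nonneg _))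

end Quadratic

/-! ### Slope and state as functionals of the second derivative -/

theorem inner_toL2_left {u : ℝ → ℝ} (hu : MemL2 u) (g : L2I) :
    inner ℝ (toL2 u hu) g = ∫ t in (-1)..1, u t * g t := by
  rw [← inner_toL2_eq hu (memL2_coe g)]
  congr 1
  exact (toL2_coe g).symm

theorem isPrimitive_rampDiff (x : ℝ) :
    IsPrimitive (fun t => ramp (-1) t - ramp x t) (fun t => rampDeriv (-1) t - rampDeriv x t) :=
  (isPrimitive_ramp (-1)).sub (isPrimitive_ramp x)

/-- Evaluation at `x` of the function with derivative `g` that vanishes at `1`. -/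
noncomputable def slopeAt (x : ℝ) : L2I →L[ℝ] ℝ :=
  -innerSL ℝ (toL2 (rampDeriv x) (memL2_rampDeriv x))

/-- Evaluation at `x` of the function `y` with `y'' = g` and `y(-1) = y'(1) = 0`. -/
noncomputable def stateAt (x : ℝ) : L2I →L[ℝ] ℝ :=
  -innerSL ℝ (toL2 _ (isPrimitive_rampDiff x).memL2)

/-- Defining evaluation as an inner product with a fixed function makes it continuous on L_2(I), so
pointwise constraints cut out closed sets; the integral formula is then recovered here. -/
theorem slopeAt_eq (g : L2I) {x : ℝ} (hx : x ∈ Ibar) : slopeAt x g = -∫ t in x..1, g t := by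
  rw [← integral_mul_rampDeriv (memL2_coe g) hx]
  simp only [slopeAt, neg_apply, innerSL_apply_apply, inner_toL2_left, mul_comm]

theorem isPrimitive_slopeAt (g : L2I) : IsPrimitive (fun x => slopeAt x g) g := by
  have h := isPrimitive_primitive (memL2_coe g).intervalIntegrable one_mem_Ibar 0
  refine h.congr fun x hx => ?_
  simp only
  rw [slopeAt_eq g hx, intervalIntegral.integral_symm, zero_add]

theorem slopeAt_one (g : L2I) : slopeAt 1 g = 0 := by
  rw [slopeAt_eq g one_mem_Ibar, intervalIntegral.integral_same, neg_zero]

/-- The kernel `ramp (-1) t - ramp x t` equals min(t, x) + 1 on [-1,1], up to sign the Green's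
function for these boundary conditions; one integration by parts gives the formula. -/
theorem stateAt_eq (g : L2I) {x : ℝ} (hx : x ∈ Ibar) :
    stateAt x g = ∫ t in (-1)..x, slopeAt t g := by
  have h := (isPrimitive_rampDiff x).integral_mul (isPrimitive_slopeAt g)
  have hp := (isPrimitive_slopeAt g).memL2
  have e1 : stateAt x g = -∫ t in (-1)..1, (ramp (-1) t - ramp x t) * g t := by
    simp only [stateAt, neg_apply, innerSL_apply_apply, inner_toL2_left]
  have e2 : ramp (-1) (-1) - ramp x (-1) = 0 := by
    simp only [ramp]
    rw [max_eq_left (by norm_num), max_eq_right (by linarith [hx.1])]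
    norm_num
  have e3 : ∫ t in (-1)..1, (rampDeriv (-1) t - rampDeriv x t) * slopeAt t g =
      (∫ t in (-1)..1, slopeAt t g * rampDeriv (-1) t) -
        ∫ t in (-1)..1, slopeAt t g * rampDeriv x t := by
    rw [← intervalIntegral.integral_sub (hp.mul (memL2_rampDeriv _)) (hp.mul (memL2_rampDeriv _))]
    exact intervalIntegral.integral_congr fun t _ => by ring
  have e4 := intervalIntegral.integral_add_adjacent_intervals
    (intervalIntegrable_mono hp.intervalIntegrable neg_one_mem_Ibar hx)
    (intervalIntegrable_mono hp.intervalIntegrable hx one_mem_Ibar)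
  rw [e1, h, e2, e3, integral_mul_rampDeriv hp neg_one_mem_Ibar, integral_mul_rampDeriv hp hx,
    slopeAt_one]
  linarith

theorem isPrimitive_stateAt (g : L2I) :
    IsPrimitive (fun x => stateAt x g) (fun x => slopeAt x g) := by
  have h := isPrimitive_primitive (isPrimitive_slopeAt g).memL2.intervalIntegrable
    neg_one_mem_Ibar 0
  refine h.congr fun x hx => ?_
  simp only
  rw [stateAt_eq g hx, zero_add]

theorem stateAt_neg_one (g : L2I) : stateAt (-1) g = 0 := by
  rw [stateAt_eq g neg_one_mem_Ibar, intervalIntegral.integral_same]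

theorem norm_toL2_le_of_bound {w : ℝ → ℝ} (hw : MemL2 w) {C : ℝ}
    (h : ∀ x ∈ Ibar, |w x| ≤ C) : ‖toL2 w hw‖ ≤ 2 * C := by
  have hC : 0 ≤ C := (abs_nonneg _).trans (h 1 one_mem_Ibar)
  rw [norm_toL2_eq, Real.sqrt_le_left (by positivity)]
  have h1 := intervalIntegral.integral_mono_on (by norm_num : (-1 : ℝ) ≤ 1) hw.sq
    (intervalIntegrable_const (c := C ^ 2)) fun x hx => by
      rw [← sq_abs]
      exact pow_le_pow_left₀ (abs_nonneg _) (h x hx) 2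
  rw [intervalIntegral.integral_const, smul_eq_mul] at h1
  nlinarith [sq_nonneg C]

theorem abs_slopeAt_le (g : L2I) (x : ℝ) : |slopeAt x g| ≤ 2 * ‖g‖ := by
  have h1 : ‖toL2 (rampDeriv x) (memL2_rampDeriv x)‖ ≤ 2 * 1 := by
    refine norm_toL2_le_of_bound _ fun t _ => ?_
    by_cases h : t ∈ Ici x <;> simp [rampDeriv, h]
  have h2 : |slopeAt x g| = |inner ℝ (toL2 (rampDeriv x) (memL2_rampDeriv x)) g| := by
    simp only [slopeAt, neg_apply, innerSL_apply_apply, abs_neg]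
  rw [h2]
  refine (abs_real_inner_le_norm _ _).trans ?_
  exact mul_le_mul_of_nonneg_right (by linarith) (norm_nonneg _)

theorem abs_stateAt_le (g : L2I) {x : ℝ} (hx : x ∈ Ibar) : |stateAt x g| ≤ 4 * ‖g‖ := by
  rw [stateAt_eq g hx, ← Real.norm_eq_abs]
  have h := intervalIntegral.norm_integral_le_of_norm_le_const (a := -1) (b := x)
    (f := fun t => slopeAt t g) (C := 2 * ‖g‖) fun t _ => abs_slopeAt_le g t
  have h2 : |x - -1| ≤ 2 := by rw [abs_le]; constructor <;> linarith [hx.1, hx.2]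
  refine h.trans ?_
  nlinarith [norm_nonneg g]

/-- The operator on `L_2(I)` given by a pointwise defined family of functionals. -/
noncomputable def pointwiseOp (ev : ℝ → L2I →L[ℝ] ℝ) (hev : ∀ g, MemL2 (fun x => ev x g)) (C : ℝ)
    (hC : ∀ g, ∀ x ∈ Ibar, |ev x g| ≤ C * ‖g‖) : L2I →L[ℝ] L2I :=
  LinearMap.mkContinuous
    { toFun := fun g => toL2 _ (hev g)
      map_add' := fun g k => by
        rw [← toL2_add]
        exact toL2_congr _ _ (Filter.Eventually.of_forall fun x => by simp)
      map_smul' := fun c g => by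
        rw [RingHom.id_apply, ← toL2_const_mul]
        exact toL2_congr _ _ (Filter.Eventually.of_forall fun x => by simp) }
    (2 * C) fun g => by
      have := norm_toL2_le_of_bound (hev g) (hC g)
      rw [mul_assoc]
      exact this

/-- The control-to-slope operator. -/
noncomputable def slopeOp : L2I →L[ℝ] L2I :=
  pointwiseOp slopeAt (fun g => (isPrimitive_slopeAt g).memL2) 2 fun g x _ => abs_slopeAt_le g x

/-- The control-to-state operator. -/
noncomputable def stateOp : L2I →L[ℝ] L2I :=
  pointwiseOp stateAt (fun g => (isPrimitive_stateAt g).memL2) 4 fun g _ hx => abs_stateAt_le g hx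

theorem stateOp_apply (g : L2I) :
    stateOp g = toL2 _ (isPrimitive_stateAt g).memL2 := rfl

/-- The second derivatives of the states that satisfy the derivative constraint. -/
def slopeBelow (s : Set ℝ) (ψ : ℝ → ℝ) : Set L2I := {g | ∀ x ∈ s, slopeAt x g ≤ ψ x}

theorem isClosed_slopeBelow (s : Set ℝ) (ψ : ℝ → ℝ) : IsClosed (slopeBelow s ψ) := by
  simp only [slopeBelow, ofPred_forall]
  exact isClosed_iInter fun x => isClosed_iInter fun _ =>
    isClosed_le (slopeAt x).continuous continuous_const

theorem convex_slopeBelow (s : Set ℝ) (ψ : ℝ → ℝ) : Convex ℝ (slopeBelow s ψ) := by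
  intro g hg k hk a b ha hb hab x hx
  have h1 := hg x hx
  have h2 := hk x hx
  simp only [map_add, map_smul, smul_eq_mul]
  have : ψ x = a * ψ x + b * ψ x := by rw [← add_mul, hab, one_mul]
  rw [this]
  exact add_le_add (mul_le_mul_of_nonneg_left h1 ha) (mul_le_mul_of_nonneg_left h2 hb)

/-- The functions on `[l,r]` that are restrictions of cubic polynomials. -/
noncomputable def cubicsOn (l r : ℝ) : Submodule ℝ (Icc l r → ℝ) :=
  (Polynomial.degreeLE ℝ ((3 : ℕ) : WithBot ℕ)).map
    (LinearMap.pi fun x : Icc l r => Polynomial.leval (x : ℝ))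

instance finiteDimensional_cubicsOn (l r : ℝ) : FiniteDimensional ℝ (cubicsOn l r) := by
  have : FiniteDimensional ℝ (Polynomial.degreeLE ℝ ((3 : ℕ) : WithBot ℕ)) := by
    classical
    rw [Polynomial.degreeLE_eq_span_X_pow]
    exact FiniteDimensional.span_finset ℝ _
  unfold cubicsOn
  infer_instance

/-- The second derivatives of the states that are cubic on `[l,r]`. -/
noncomputable def cubicStates (l r : ℝ) : Submodule ℝ L2I :=
  (cubicsOn l r).comap (LinearMap.pi fun x : Icc l r => (stateAt (x : ℝ)).toLinearMap)

/-- Cubics form a finite-dimensional, hence closed, subspace of the functions on [l, r] under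
pointwise convergence, and restricting the state is continuous into that space. -/
theorem isClosed_cubicStates (l r : ℝ) : IsClosed (cubicStates l r : Set L2I) := by
  have hc : Continuous fun g : L2I => fun x : Icc l r => stateAt (x : ℝ) g :=
    continuous_pi fun x => (stateAt (x : ℝ)).continuous
  exact (Submodule.closed_of_finiteDimensional (cubicsOn l r)).preimage hc

theorem mem_cubicStates {l r : ℝ} {g : L2I} : g ∈ cubicStates l r ↔
    ∃ P : Polynomial ℝ, P.degree ≤ 3 ∧ ∀ x ∈ Icc l r, stateAt x g = P.eval x := by
  constructor
  · rintro ⟨P, hP, hPe⟩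
    exact ⟨P, Polynomial.mem_degreeLE.1 hP, fun x hx => (congrFun hPe ⟨x, hx⟩).symm⟩
  · rintro ⟨P, hP, hPe⟩
    exact ⟨P, Polynomial.mem_degreeLE.2 hP, funext fun x => (hPe x x.2).symm⟩

/-- States with constant second derivative on an interval are polynomial there. -/
theorem mem_cubicStates_of_const {l r A : ℝ} (hl : l ∈ Ibar) (hr : r ∈ Ibar) {g : L2I}
    (hg : ∀ x ∈ Icc l r, ∫ t in l..x, g t = A * (x - l)) : g ∈ cubicStates l r := by
  have hsub : Icc l r ⊆ Ibar := Icc_subset_Icc hl.1 hr.2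
  have h1 : ∀ x ∈ Icc l r, slopeAt x g = slopeAt l g + A * (x - l) := fun x hx => by
    rw [← hg x hx, (isPrimitive_slopeAt g).integral_eq hl (hsub hx)]
    ring
  have h2 : ∀ x ∈ Icc l r, stateAt x g = stateAt l g + slopeAt l g * (x - l) +
      A / 2 * (x - l) ^ 2 := by
    intro x hx
    have h3 := (isPrimitive_stateAt g).integral_eq hl (hsub hx)
    have h4 : ∫ t in l..x, slopeAt t g = ∫ t in l..x, (slopeAt l g + A * (t - l)) := by
      refine intervalIntegral.integral_congr fun t ht => ?_
      rw [uIcc_of_le hx.1] at ht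
      exact h1 t ⟨ht.1, ht.2.trans hx.2⟩
    have h5 : ∫ t in l..x, (slopeAt l g + A * (t - l)) =
        slopeAt l g * (x - l) + A / 2 * (x - l) ^ 2 := by
      rw [intervalIntegral.integral_eq_sub_of_hasDerivAt
        (f := fun t => slopeAt l g * (t - l) + A / 2 * (t - l) ^ 2)]
      · ring
      · intro t _
        have hd : HasDerivAt (fun t : ℝ => t - l) 1 t := (hasDerivAt_id t).sub_const l
        have := (hd.const_mul (slopeAt l g)).add ((hd.pow 2).const_mul (A / 2))
        refine this.congr_deriv ?_
        simp
        ring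
      · apply Continuous.intervalIntegrable
        fun_prop
    linarith
  refine mem_cubicStates.2 ⟨Polynomial.C (stateAt l g) +
    Polynomial.C (slopeAt l g) * (Polynomial.X - Polynomial.C l) +
    Polynomial.C (A / 2) * (Polynomial.X - Polynomial.C l) ^ 2, ?_, fun x hx => ?_⟩
  · refine le_trans (b := ((2 : ℕ) : WithBot ℕ)) ?_ (by norm_cast)
    compute_degree
    norm_num
  · rw [h2 x hx]
    simp

/-! ### The optimal control problem in terms of the second derivative -/

/-- The second derivative as an element of `L_2(I)`. -/
noncomputable def H2.curv (y : H2) : L2I := toL2 y.d2 y.d2_mem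

/-- The state with a given second derivative. -/
noncomputable def ofL2 (g : L2I) : H2 where
  val x := stateAt x g
  d1 x := slopeAt x g
  d2 := g
  val_cont := (isPrimitive_stateAt g).continuousOn
  d1_cont := (isPrimitive_slopeAt g).continuousOn
  d2_mem := memL2_coe g
  weak1 := (isPrimitive_stateAt g).hasWeakDeriv
  weak2 := (isPrimitive_slopeAt g).hasWeakDeriv

theorem curv_ofL2 (g : L2I) : (ofL2 g).curv = g := toL2_coe g

theorem inV_ofL2 (g : L2I) : InV (ofL2 g) := ⟨stateAt_neg_one g, slopeAt_one g⟩

theorem InV.d1_eq {y : H2} (hy : InV y) {x : ℝ} (hx : x ∈ Ibar) : y.d1 x = slopeAt x y.curv := by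
  have h := y.isPrimitive_d1.integral_eq hx one_mem_Ibar
  rw [slopeAt_eq _ hx, H2.curv, intervalIntegral_congr_ae_I (coe_toL2 y.d2_mem) hx one_mem_Ibar, h,
    hy.2]
  ring

theorem InV.val_eq {y : H2} (hy : InV y) {x : ℝ} (hx : x ∈ Ibar) : y.val x = stateAt x y.curv := by
  have h := y.isPrimitive_val.integral_eq neg_one_mem_Ibar hx
  rw [hy.1, sub_zero] at h
  rw [stateAt_eq _ hx, ← h]
  refine intervalIntegral.integral_congr fun t ht => hy.d1_eq ?_
  rw [uIcc_of_le hx.1] at ht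
  exact ⟨ht.1, ht.2.trans hx.2⟩

theorem l2Norm_eq {w : ℝ → ℝ} (hw : MemL2 w) : l2Norm w = ‖toL2 w hw‖ := by
  rw [norm_toL2_eq, l2Norm, integral_I]

theorem ae_I_of_forall {p : ℝ → Prop} (h : ∀ x ∈ Ibar, p x) : ∀ᵐ x ∂volume.restrict I, p x := by
  rw [ae_restrict_iff' measurableSet_Ioo]
  exact Filter.Eventually.of_forall fun x hx => h x (Ioo_subset_Icc_self hx)

theorem l2Norm_congr {v w : ℝ → ℝ} (h : v =ᵐ[volume.restrict I] w) : l2Norm v = l2Norm w := by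
  unfold l2Norm
  congr 1
  refine integral_congr_ae ?_
  filter_upwards [h] with x hx
  rw [hx]

theorem H2.memL2_val (y : H2) : MemL2 y.val := memL2_of_continuousOn y.val_cont

theorem H2.memL2_d1 (y : H2) : MemL2 y.d1 := memL2_of_continuousOn y.d1_cont

theorem InV.stateOp_curv {y : H2} (hy : InV y) : stateOp y.curv = toL2 y.val y.memL2_val :=
  toL2_congr (isPrimitive_stateAt _).memL2 _ (ae_I_of_forall fun _ hx => (hy.val_eq hx).symm)

theorem InV.slopeOp_curv {y : H2} (hy : InV y) : slopeOp y.curv = toL2 y.d1 y.memL2_d1 :=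
  toL2_congr (isPrimitive_slopeAt _).memL2 _ (ae_I_of_forall fun _ hx => (hy.d1_eq hx).symm)

theorem memL2_control {f : ℝ → ℝ} (hf : MemL2 f) (y : H2) : MemL2 (control f y) := by
  have := (y.d2_mem.const_mul (-1)).sub hf
  refine MemLp.ae_eq (Filter.Eventually.of_forall fun x => ?_) this
  simp [control]

theorem J_eq_cost {β : ℝ} {yd f u : ℝ → ℝ} (hyd : MemL2 yd) (hf : MemL2 f) {y : H2} (hy : InV y)
    (hu : u =ᵐ[volume.restrict I] control f y) :
    J β yd y.val u = cost β stateOp (toL2 yd hyd) (toL2 f hf) y.curv := by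
  have h1 : l2Norm (fun x => y.val x - yd x) = ‖stateOp y.curv - toL2 yd hyd‖ := by
    rw [l2Norm_eq (y.memL2_val.sub hyd), toL2_sub, hy.stateOp_curv]
  have h2 : l2Norm u = ‖y.curv + toL2 f hf‖ := by
    have : u =ᵐ[volume.restrict I] fun x => (-1) * (y.d2 x + f x) := by
      filter_upwards [hu] with x hx
      rw [hx, control]
      ring
    rw [l2Norm_congr this, l2Norm_eq ((y.d2_mem.add hf).const_mul (-1)), toL2_const_mul _ (y.d2_mem.add hf), toL2_add y.d2_mem hf,
      norm_smul, norm_neg, norm_one, one_mul]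
    rfl
  rw [J, cost, h1, h2]

/-- Every g in L_2(I) is the second derivative of a member of V, and the state equation fixes the
control almost everywhere, so only the slope constraint on g survives. -/
theorem isOptimal_iff {β : ℝ} {yd f u : ℝ → ℝ} (hyd : MemL2 yd) (hf : MemL2 f) {ψ y : H2} :
    IsOptimal β yd f ψ y u ↔ InV y ∧ u =ᵐ[volume.restrict I] control f y ∧
      y.curv ∈ slopeBelow I ψ.val ∧ ∀ k ∈ slopeBelow I ψ.val,
        cost β stateOp (toL2 yd hyd) (toL2 f hf) y.curv ≤
          cost β stateOp (toL2 yd hyd) (toL2 f hf) k := by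
  have hadm : ∀ {z : H2} {w : ℝ → ℝ}, Admissible f ψ z w ↔
      InV z ∧ w =ᵐ[volume.restrict I] control f z ∧ z.curv ∈ slopeBelow I ψ.val := by
    intro z w
    constructor
    · intro h
      refine ⟨h.boundary, ?_, fun x hx => ?_⟩
      · filter_upwards [h.state] with x hx
        rw [control, hx]
        ring
      · rw [← h.boundary.d1_eq (Ioo_subset_Icc_self hx)]
        exact h.constraint x hx
    · rintro ⟨hz, hw, hK⟩
      refine ⟨MemLp.ae_eq hw.symm (memL2_control hf z), ?_, fun x hx => ?_, hz⟩
      · filter_upwards [hw] with x hx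
        rw [hx, control]
        ring
      · rw [hz.d1_eq (Ioo_subset_Icc_self hx)]
        exact hK x hx
  constructor
  · rintro ⟨h, hmin⟩
    obtain ⟨hy, hu, hK⟩ := hadm.1 h
    refine ⟨hy, hu, hK, fun k hk => ?_⟩
    have h1 := hmin (ofL2 k) (control f (ofL2 k))
      (hadm.2 ⟨inV_ofL2 k, Filter.EventuallyEq.rfl, by rwa [curv_ofL2]⟩)
    rwa [J_eq_cost hyd hf hy hu, J_eq_cost hyd hf (inV_ofL2 k) Filter.EventuallyEq.rfl,
      curv_ofL2] at h1
  · rintro ⟨hy, hu, hK, hmin⟩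
    refine ⟨hadm.2 ⟨hy, hu, hK⟩, fun z w hzw => ?_⟩
    obtain ⟨hz, hw, hzK⟩ := hadm.1 hzw
    rw [J_eq_cost hyd hf hy hu, J_eq_cost hyd hf hz hw]
    exact hmin _ hzK

/-! ### Meshes and the discrete feasible set -/

namespace Mesh

/-- The grid points as a sequence, constant from the last one on. -/
def nodeSeq (T : Mesh) (i : ℕ) : ℝ := T.node ⟨min i T.n, by omega⟩

theorem nodeSeq_eq_left (T : Mesh) (i : Fin T.n) : T.nodeSeq i = T.left i := by
  unfold nodeSeq left
  congr 1
  ext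
  simp [i.2.le]

theorem nodeSeq_eq_right (T : Mesh) (i : Fin T.n) : T.nodeSeq (i + 1) = T.right i := by
  unfold nodeSeq right
  congr 1
  ext
  simp [Nat.succ_le_of_lt i.2]

theorem left_lt_right (T : Mesh) (i : Fin T.n) : T.left i < T.right i :=
  T.strictMono Fin.castSucc_lt_succ

theorem length_le_h (T : Mesh) (i : Fin T.n) : T.length i ≤ T.h :=
  le_ciSup (Set.finite_range T.length).bddAbove i

theorem isNodes (T : Mesh) : IsNodes T.n T.nodeSeq T.h where
  first := by
    rw [← T.first]
    unfold nodeSeq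
    congr 1
  last := by
    rw [← T.last]
    unfold nodeSeq
    congr 1
    ext
    simp
  lt i hi := by
    have := T.left_lt_right ⟨i, hi⟩
    rwa [← nodeSeq_eq_left, ← nodeSeq_eq_right] at this
  le i hi := by
    have := T.length_le_h ⟨i, hi⟩
    rwa [length, ← nodeSeq_eq_left, ← nodeSeq_eq_right] at this

theorem node_mem (T : Mesh) (j : Fin (T.n + 1)) : T.node j ∈ Ibar :=
  ⟨T.first ▸ T.strictMono.monotone (Fin.zero_le j), T.last ▸ T.strictMono.monotone (Fin.le_last j)⟩

theorem left_mem (T : Mesh) (i : Fin T.n) : T.left i ∈ Ibar := T.node_mem _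

theorem right_mem (T : Mesh) (i : Fin T.n) : T.right i ∈ Ibar := T.node_mem _

end Mesh

/-- The second derivatives of the members of `K_h`. -/
def discreteSet (T : Mesh) (ψ : ℝ → ℝ) : Set L2I :=
  (⋂ i, (cubicStates (T.left i) (T.right i) : Set L2I)) ∩ slopeBelow (range T.node) ψ

theorem isClosed_discreteSet (T : Mesh) (ψ : ℝ → ℝ) : IsClosed (discreteSet T ψ) :=
  (isClosed_iInter fun _ => isClosed_cubicStates _ _).inter (isClosed_slopeBelow _ _)

theorem convex_discreteSet (T : Mesh) (ψ : ℝ → ℝ) : Convex ℝ (discreteSet T ψ) :=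
  (convex_iInter fun _ => Submodule.convex _).inter (convex_slopeBelow _ _)

/-- An inequality between affine functions on an element amounts to the inequalities at its end
points. At the last node the slope is zero and `hψ` applies. -/
theorem inKh_iff {T : Mesh} {ψ v : H2} (hψ : 0 ≤ ψ.val 1) :
    InKh T ψ v ↔ InV v ∧ v.curv ∈ discreteSet T ψ.val := by
  have hsub : ∀ i, Icc (T.left i) (T.right i) ⊆ Ibar := fun i =>
    Icc_subset_Icc (T.left_mem i).1 (T.right_mem i).2
  have hlen : ∀ i, 0 < T.length i := fun i => sub_pos.2 (T.left_lt_right i)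
  constructor
  · rintro ⟨⟨hv, hP⟩, hle⟩
    refine ⟨hv, mem_iInter.2 fun i => ?_, ?_⟩
    · obtain ⟨P, hPd, hPe⟩ := hP i
      exact mem_cubicStates.2 ⟨P, hPd, fun x hx => by rw [← hPe x hx, hv.val_eq (hsub i hx)]⟩
    · rintro _ ⟨j, rfl⟩
      rw [← hv.d1_eq (T.node_mem j)]
      rcases Fin.eq_castSucc_or_eq_last j with ⟨i, rfl⟩ | rfl
      · have h1 := hle i (T.left i) (left_mem_Icc.2 (T.left_lt_right i).le)
        have h2 : (T.right i - T.left i) / T.length i = 1 := div_self (hlen i).ne'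
        simp only [p1Interp, sub_self, zero_div, zero_mul, add_zero, h2, one_mul] at h1
        exact h1
      · rw [T.last, hv.2]
        exact hψ
  · rintro ⟨hv, hc, hs⟩
    refine ⟨⟨hv, fun i => ?_⟩, fun i x hx => ?_⟩
    · obtain ⟨P, hPd, hPe⟩ := mem_cubicStates.1 (mem_iInter.1 hc i)
      exact ⟨P, hPd, fun x hx => by rw [← hPe x hx, hv.val_eq (hsub i hx)]⟩
    · have h1 : v.d1 (T.left i) ≤ ψ.val (T.left i) := by
        rw [hv.d1_eq (T.left_mem i)]
        exact hs _ ⟨_, rfl⟩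
      have h2 : v.d1 (T.right i) ≤ ψ.val (T.right i) := by
        rw [hv.d1_eq (T.right_mem i)]
        exact hs _ ⟨_, rfl⟩
      exact add_le_add
        (mul_le_mul_of_nonneg_left h1 (div_nonneg (sub_nonneg.2 hx.2) (hlen i).le))
        (mul_le_mul_of_nonneg_left h2 (div_nonneg (sub_nonneg.2 hx.1) (hlen i).le))

theorem isDiscreteOptimal_iff {T : Mesh} {β : ℝ} {yd f : ℝ → ℝ} (hyd : MemL2 yd) (hf : MemL2 f)
    {ψ v : H2} (hψ : 0 ≤ ψ.val 1) :
    IsDiscreteOptimal T β yd f ψ v ↔ InV v ∧ v.curv ∈ discreteSet T ψ.val ∧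
      ∀ k ∈ discreteSet T ψ.val, cost β stateOp (toL2 yd hyd) (toL2 f hf) v.curv ≤
          cost β stateOp (toL2 yd hyd) (toL2 f hf) k := by
  constructor
  · rintro ⟨h, hmin⟩
    obtain ⟨hv, hK⟩ := (inKh_iff hψ).1 h
    refine ⟨hv, hK, fun k hk => ?_⟩
    have h1 := hmin (ofL2 k) ((inKh_iff hψ).2 ⟨inV_ofL2 k, by rwa [curv_ofL2]⟩)
    rwa [J_eq_cost hyd hf hv Filter.EventuallyEq.rfl,
      J_eq_cost hyd hf (inV_ofL2 k) Filter.EventuallyEq.rfl, curv_ofL2] at h1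
  · rintro ⟨hv, hK, hmin⟩
    refine ⟨(inKh_iff hψ).2 ⟨hv, hK⟩, fun z hz => ?_⟩
    obtain ⟨hz, hzK⟩ := (inKh_iff hψ).1 hz
    rw [J_eq_cost hyd hf hv Filter.EventuallyEq.rfl, J_eq_cost hyd hf hz Filter.EventuallyEq.rfl]
    exact hmin _ hzK

/-- A quadratic state that is feasible for the continuous and all discrete problems. -/
theorem exists_feasible {ψ : H2} (hψ : 0 ≤ ψ.val 1) :
    ∃ g : L2I, g ∈ slopeBelow I ψ.val ∧ ∀ T : Mesh, g ∈ discreteSet T ψ.val := by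
  obtain ⟨L, hL⟩ := isCompact_Icc.exists_bound_of_continuousOn ψ.d1_cont
  have hm : MemL2 (fun _ => L) := memL2_of_continuousOn continuousOn_const
  have hint : ∀ a ∈ Ibar, ∀ b ∈ Ibar, ∫ t in a..b, toL2 (fun _ => L) hm t = L * (b - a) := by
    intro a ha b hb
    rw [intervalIntegral_congr_ae_I (coe_toL2 hm) ha hb, intervalIntegral.integral_const, smul_eq_mul,
      mul_comm]
  -- The slope is -L(1 - x), and ψ(x) ≥ ψ(1) - L(1 - x) since L bounds |ψ'|; now ψ(1) ≥ 0.
  have hs : ∀ x ∈ Ibar, slopeAt x (toL2 (fun _ => L) hm) ≤ ψ.val x := by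
    intro x hx
    rw [slopeAt_eq _ hx, hint x hx 1 one_mem_Ibar]
    have h1 := ψ.isPrimitive_val.integral_eq hx one_mem_Ibar
    have h2 := intervalIntegral.integral_mono_on hx.2
      (intervalIntegrable_mono ψ.memL2_d1.intervalIntegrable hx one_mem_Ibar)
      (intervalIntegrable_const (c := L)) fun t ht =>
        (le_abs_self _).trans (hL t ⟨hx.1.trans ht.1, ht.2⟩)
    rw [intervalIntegral.integral_const, smul_eq_mul] at h2
    linarith
  refine ⟨toL2 (fun _ => L) hm, fun x hx => hs x (Ioo_subset_Icc_self hx), fun T =>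
    ⟨mem_iInter.2 fun i => mem_cubicStates_of_const (T.left_mem i) (T.right_mem i) fun x hx =>
      hint _ (T.left_mem i) x ⟨(T.left_mem i).1.trans hx.1, hx.2.trans (T.right_mem i).2⟩, ?_⟩⟩
  rintro _ ⟨j, rfl⟩
  exact hs _ (T.node_mem j)

/-! ### Gradient, optimality condition and error estimate -/

/-- The derivative of the reduced cost is represented by a function of the form `β g + F` with an
absolutely continuous `F`. -/
theorem exists_gradient {β : ℝ} {yd f : ℝ → ℝ} (hyd : MemL2 yd) (hf : MemH1 f) (g : L2I) :
    ∃ (G F φ : ℝ → ℝ) (hG : MemL2 G), IsPrimitive F φ ∧ MemL2 φ ∧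
      (∀ᵐ x ∂volume.restrict I, G x = β * g x + F x) ∧
      ∀ r : L2I, inner ℝ (stateOp g - toL2 yd hyd) (stateOp r) + β * inner ℝ (g + toL2 f hf.1) r =
        inner ℝ (toL2 G hG) r := by
  obtain ⟨hf2, f', hf', hff'⟩ := hf
  obtain ⟨fc, hfc, hfp⟩ := hff'.exists_isPrimitive hf2.integrable hf'.integrable
  have hw : MemL2 (fun x => stateAt x g - yd x) := (isPrimitive_stateAt g).memL2.sub hyd
  -- Φ is the adjoint state: Φ' = W, W' = y - y_d, W(1) = 0 and Φ(-1) = 0. With these end conditions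
  -- two integrations by parts leave no boundary terms.
  have hW := isPrimitive_primitive hw.intervalIntegrable one_mem_Ibar 0
  set W : ℝ → ℝ := fun x => 0 + ∫ t in (1 : ℝ)..x, (stateAt t g - yd t) with hWdef
  have hP := isPrimitive_primitive hW.memL2.intervalIntegrable neg_one_mem_Ibar 0
  set Φ : ℝ → ℝ := fun x => 0 + ∫ t in (-1)..x, W t with hPdef
  have hW1 : W 1 = 0 := by simp [hWdef]
  have hP1 : Φ (-1) = 0 := by simp [hPdef]
  -- G contains f itself while F contains its continuous representative, hence G = βg + F only
  -- almost everywhere.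
  have hG : MemL2 (fun x => β * g x + (β * f x + Φ x)) :=
    ((memL2_coe g).const_mul β).add ((hf2.const_mul β).add hP.memL2)
  refine ⟨_, fun x => β * fc x + Φ x, fun x => β * f' x + W x, hG, (hfp.const_mul β).add hP,
    (hf'.const_mul β).add hW.memL2, ?_, fun r => ?_⟩
  · filter_upwards [hfc] with x hx
    rw [hx]
  · have e1 : inner ℝ (stateOp g - toL2 yd hyd) (stateOp r) = inner ℝ (toL2 Φ hP.memL2) r := by
      rw [stateOp_apply, stateOp_apply, ← toL2_sub, inner_toL2_eq, ← toL2_coe r, inner_toL2_eq,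
        toL2_coe]
      have h1 := (isPrimitive_stateAt r).integral_mul hW
      have h2 := (isPrimitive_slopeAt r).integral_mul hP
      rw [hW1, stateAt_neg_one] at h1
      rw [hP1, slopeAt_one] at h2
      have h3 : ∫ t in (-1)..1, (stateAt t g - yd t) * stateAt t r =
          ∫ t in (-1)..1, stateAt t r * (stateAt t g - yd t) :=
        intervalIntegral.integral_congr fun t _ => mul_comm _ _
      have h4 : ∫ t in (-1)..1, Φ t * r t = ∫ t in (-1)..1, r t * Φ t :=
        intervalIntegral.integral_congr fun t _ => mul_comm _ _
      rw [h3, h1, h2, h4]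
      ring
    rw [toL2_add ((memL2_coe g).const_mul β) ((hf2.const_mul β).add hP.memL2),
      toL2_add (hf2.const_mul β) hP.memL2, toL2_const_mul _ (memL2_coe g), toL2_const_mul _ hf2,
      toL2_coe, e1]
    simp only [inner_add_left, real_inner_smul_left]
    ring

theorem slopeAt_toL2 {q r : ℝ → ℝ} (hq : IsPrimitive q r) (hr : MemL2 r) (hq1 : q 1 = 0) {x : ℝ}
    (hx : x ∈ Ibar) : slopeAt x (toL2 r hr) = q x := by
  rw [slopeAt_eq _ hx, intervalIntegral_congr_ae_I (coe_toL2 hr) hx one_mem_Ibar,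
    hq.integral_eq hx one_mem_Ibar, hq1]
  ring

theorem slopeBelow_le_on_Ibar {ψ : H2} {g : L2I} (hg : g ∈ slopeBelow I ψ.val) {x : ℝ}
    (hx : x ∈ Ibar) : slopeAt x g ≤ ψ.val x := by
  have hcl : closure I = Ibar := closure_Ioo (by norm_num)
  refine le_on_closure (s := I) (f := fun x => slopeAt x g) (g := ψ.val) hg ?_ ?_ ?_
  · rw [hcl]; exact (isPrimitive_slopeAt g).continuousOn
  · rw [hcl]; exact ψ.val_cont
  · rwa [hcl]

/-- The obstacle problem solved by the derivative of the optimal state. -/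
theorem obstacleVI_of_minimizer {β : ℝ} (hβ : 0 < β) {yd f : ℝ → ℝ} (hyd : MemL2 yd)
    (hf : MemL2 f) {ψ : H2} {g : L2I} (hg : g ∈ slopeBelow I ψ.val)
    (hmin : ∀ k ∈ slopeBelow I ψ.val, cost β stateOp (toL2 yd hyd) (toL2 f hf) g ≤
      cost β stateOp (toL2 yd hyd) (toL2 f hf) k)
    {G F φ : ℝ → ℝ} (hG : MemL2 G) (hF : IsPrimitive F φ)
    (hGF : ∀ᵐ x ∂volume.restrict I, G x = β * g x + F x)
    (hgrad : ∀ r : L2I, inner ℝ (stateOp g - toL2 yd hyd) (stateOp r) +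
      β * inner ℝ (g + toL2 f hf) r = inner ℝ (toL2 G hG) r) :
    ObstacleVI β G (fun x => ψ.val x - slopeAt x g) (fun x => β * ψ.d1 x + F x)
      (fun x => β * ψ.d2 x + φ x) where
  pos := hβ
  memL2 := hG
  gap_cont := ψ.val_cont.sub (isPrimitive_slopeAt g).continuousOn
  gap_nonneg x hx := sub_nonneg.2 (slopeBelow_le_on_Ibar hg hx)
  -- Adding q to the slope keeps it below ψ precisely when q is at most the gap.
  vi q r hq hr hq1 hle := by
    have hk : g + toL2 r hr ∈ slopeBelow I ψ.val := by
      intro x hx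
      have hxI := Ioo_subset_Icc_self hx
      rw [map_add, slopeAt_toL2 hq hr hq1 hxI]
      linarith [hle x hxI]
    have h := cost_variational_inequality stateOp (convex_slopeBelow I ψ.val) hg hmin hk
    rwa [add_sub_cancel_left, hgrad, inner_toL2_eq] at h
  reg := (ψ.isPrimitive_d1.const_mul β).add hF
  rel a ha b hb := by
    have hFi := intervalIntegrable_mono hF.memL2.intervalIntegrable ha hb
    have hgi := intervalIntegrable_mono (memL2_coe g).intervalIntegrable ha hb
    have hdi := intervalIntegrable_mono ψ.memL2_d1.intervalIntegrable ha hb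
    rw [intervalIntegral_congr_ae_I hGF ha hb,
      intervalIntegral.integral_add (hgi.const_mul β) hFi,
      intervalIntegral.integral_add (hdi.const_mul β) hFi,
      intervalIntegral.integral_const_mul, intervalIntegral.integral_const_mul,
      (isPrimitive_slopeAt g).integral_eq ha hb, ψ.isPrimitive_val.integral_eq ha hb]
    ring

/-- Averaging the second derivative over the elements leads from the feasible set to the discrete
feasible set. -/
theorem toL2_stepMean_mem {T : Mesh} {ψ : H2} {g : L2I} (hg : g ∈ slopeBelow I ψ.val) :
    toL2 (stepMean T.n T.nodeSeq g) (memL2_stepMean _ _ _) ∈ discreteSet T ψ.val := by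
  have hN := T.isNodes
  refine ⟨mem_iInter.2 fun i => ?_, ?_⟩
  · refine mem_cubicStates_of_const (A := avg T.nodeSeq g i) (T.left_mem i) (T.right_mem i)
      fun x hx => ?_
    have hxI : x ∈ Ibar := ⟨(T.left_mem i).1.trans hx.1, hx.2.trans (T.right_mem i).2⟩
    rw [intervalIntegral_congr_ae_I (coe_toL2 _) (T.left_mem i) hxI]
    have : ∫ t in T.left i..x, stepMean T.n T.nodeSeq g t =
        ∫ _ in T.left i..x, avg T.nodeSeq g i := by
      refine intervalIntegral.integral_congr_ae (Filter.Eventually.of_forall fun t ht => ?_)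
      rw [uIoc_of_le hx.1] at ht
      refine hN.stepMean_eq _ i.2 ?_
      rw [T.nodeSeq_eq_left, T.nodeSeq_eq_right]
      exact ⟨ht.1, ht.2.trans hx.2⟩
    rw [this, intervalIntegral.integral_const, smul_eq_mul, mul_comm]
  · rintro _ ⟨j, rfl⟩
    have hj : T.node j = T.nodeSeq j := by
      unfold Mesh.nodeSeq
      congr 1
      ext
      simp [Nat.le_of_lt_succ j.2]
    have hmem := T.node_mem j
    have hle := slopeBelow_le_on_Ibar hg hmem
    rw [slopeAt_eq _ hmem] at hle ⊢
    -- Averaging preserves integrals over whole elements, so the slopes at the nodes do not change.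
    rw [intervalIntegral_congr_ae_I (coe_toL2 _) hmem one_mem_Ibar, hj,
      hN.integral_stepMean_tail (memL2_coe g).intervalIntegrable (Nat.le_of_lt_succ j.2), ← hj]
    exact hle

/-- If E exceeded (a + b + 1)H, then E² would exceed aHE by more than (b + 1)HE, which is at least
bH². -/
theorem linear_bound_of_quadratic {E H a b : ℝ} (hH : 0 < H) (ha : 0 ≤ a) (hb : 0 ≤ b)
    (h : E ^ 2 ≤ a * H * E + b * H ^ 2) : E ≤ (a + b + 1) * H := by
  by_contra hcon
  have hcon := not_le.1 hcon
  have h0 : 0 < (a + b + 1) * H := by positivity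
  have h1 : (a + b + 1) * H * E < E * E := mul_lt_mul_of_pos_right hcon (h0.trans hcon)
  have h2 : (b + 1) * H * ((a + b + 1) * H) ≤ (b + 1) * H * E :=
    mul_le_mul_of_nonneg_left hcon.le (by positivity)
  have h3 : b * H ^ 2 ≤ (b + 1) * H * ((a + b + 1) * H) := by
    have : 0 ≤ H ^ 2 * (a * b + b ^ 2 + b + a + 1) := by positivity
    nlinarith
  nlinarith

/-- The discretization error of the second derivative is of first order in the mesh size. -/
theorem exists_error_bound {β : ℝ} (hβ : 0 < β) {yd f : ℝ → ℝ} (hyd : MemL2 yd)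
    (hf : MemH1 f) {ψ : H2} {g : L2I} (hg : g ∈ slopeBelow I ψ.val)
    (hmin : ∀ k ∈ slopeBelow I ψ.val, cost β stateOp (toL2 yd hyd) (toL2 f hf.1) g ≤
      cost β stateOp (toL2 yd hyd) (toL2 f hf.1) k) :
    ∃ C : ℝ, 0 ≤ C ∧ ∀ T : Mesh, ∀ gh ∈ discreteSet T ψ.val,
      (∀ k ∈ discreteSet T ψ.val, cost β stateOp (toL2 yd hyd) (toL2 f hf.1) gh ≤
        cost β stateOp (toL2 yd hyd) (toL2 f hf.1) k) → ‖gh - g‖ ≤ C * T.h := by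
  obtain ⟨G, F, φ, hG, hF, hφ, hGF, hgrad⟩ := exists_gradient (β := β) hyd hf g
  have ho := obstacleVI_of_minimizer hβ hyd hf.1 hg hmin hG hF hGF hgrad
  set e : ℝ → ℝ := fun x => β * ψ.d2 x + φ x with hedef
  have he : MemL2 e := (ψ.d2_mem.const_mul β).add hφ
  -- As g = (G - F)/β, its oscillation on an element is at most the integral of m: |e| accounts for
  -- G and |φ| for F.
  have hm : MemL2 (fun x => β⁻¹ * (|e x| + |φ x|)) := ((memL2_abs he).add (memL2_abs hφ)).const_mul _
  set m : ℝ → ℝ := fun x => β⁻¹ * (|e x| + |φ x|) with hmdef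
  set ν := Real.sqrt (∫ t in (-1)..1, e t ^ 2) with hν
  set μ := Real.sqrt (∫ t in (-1)..1, m t ^ 2) with hμ
  set N := ‖(stateOp : L2I →L[ℝ] L2I)‖ with hN
  have hν0 : 0 ≤ ν := Real.sqrt_nonneg _
  have hμ0 : 0 ≤ μ := Real.sqrt_nonneg _
  have hN0 : 0 ≤ N := norm_nonneg _
  -- This is a + b + 1 from `linear_bound_of_quadratic`, with a = μ + ν/β and b the quotient by β
  -- that follows.
  refine ⟨(μ + ν / β) + (N ^ 2 * μ ^ 2 / 4 + ν * μ + 9 * ν ^ 2 / β) / β + 1, by positivity,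
    fun T gh hgh hminh => ?_⟩
  have hT := T.isNodes
  have hH := hT.H_pos
  set k : L2I := toL2 (stepMean T.n T.nodeSeq g) (memL2_stepMean _ _ _) with hk
  have hkK : k ∈ discreteSet T ψ.val := toL2_stepMean_mem hg
  have hvi := cost_variational_inequality stateOp (convex_discreteSet T ψ.val) hgh hminh hkK
  have hδ : ‖k - g‖ ≤ T.h * μ := by
    have h1 : ‖k - g‖ = Real.sqrt (∫ t in (-1)..1, (g t - stepMean T.n T.nodeSeq g t) ^ 2) := by
      rw [← norm_toL2_eq ((memL2_coe g).sub (memL2_stepMean _ _ _)), toL2_sub (memL2_coe g)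
        (memL2_stepMean _ _ _), toL2_coe, norm_sub_rev]
    rw [h1, hμ, ← Real.sqrt_sq hH.le, ← Real.sqrt_mul (sq_nonneg _)]
    refine Real.sqrt_le_sqrt (hT.integral_sq_sub_stepMean_le (memL2_coe g) hm fun i hi => ?_)
    obtain ⟨lo, hi', -, hε, hb, -⟩ := ho.secant_bounds (hT.mem hi.le) (hT.mem hi) (hT.lt i hi)
    have hle := hT.lt i hi
    have ha1 := hT.abs_sub_avg_le_of_secant_bounds hi hG.intervalIntegrable hε hb
    have hGF' := hGF
    rw [ae_restrict_iff' measurableSet_Ioo] at hGF'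
    have h1 : ∀ᵐ x : ℝ, x ≠ 1 := by simp [ae_iff, measure_singleton]
    have hei := intervalIntegrable_mono (memL2_abs he).intervalIntegrable (hT.mem hi.le) (hT.mem hi)
    have hφi := intervalIntegrable_mono (memL2_abs hφ).intervalIntegrable (hT.mem hi.le) (hT.mem hi)
    have hmi : ∫ s in T.nodeSeq i..T.nodeSeq (i + 1), |m s| =
        β⁻¹ * ((∫ s in T.nodeSeq i..T.nodeSeq (i + 1), |e s|) +
          ∫ s in T.nodeSeq i..T.nodeSeq (i + 1), |φ s|) := by
      rw [← intervalIntegral.integral_add hei hφi, ← intervalIntegral.integral_const_mul]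
      exact intervalIntegral.integral_congr fun s _ => abs_of_nonneg (by positivity)
    have havg : avg T.nodeSeq G i = β * avg T.nodeSeq g i + avg T.nodeSeq F i := by
      unfold avg
      rw [intervalIntegral_congr_ae_I hGF (hT.mem hi.le) (hT.mem hi), intervalIntegral.integral_add,
        intervalIntegral.integral_const_mul]
      · ring
      · exact (intervalIntegrable_mono (memL2_coe g).intervalIntegrable (hT.mem hi.le)
          (hT.mem hi)).const_mul β
      · exact intervalIntegrable_mono hF.memL2.intervalIntegrable (hT.mem hi.le) (hT.mem hi)
    filter_upwards [ha1, hGF', h1] with t ht1 ht2 ht3 htI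
    have htI' : t ∈ I := ⟨lt_of_le_of_lt (hT.mem hi.le).1 htI.1,
      lt_of_le_of_ne (htI.2.trans (hT.mem hi).2) ht3⟩
    have h4 := hT.abs_sub_avg_le_of_isPrimitive hF hi htI
    have h5 := ht1 htI
    have h6 : g t - avg T.nodeSeq g i = β⁻¹ * ((G t - avg T.nodeSeq G i) -
        (F t - avg T.nodeSeq F i)) := by
      rw [ht2 htI', havg]
      field_simp
      ring
    rw [hmi, h6, abs_mul, abs_of_pos (inv_pos.2 hβ)]
    exact mul_le_mul_of_nonneg_left ((abs_sub _ _).trans (add_le_add h5 h4)) (inv_pos.2 hβ).le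
  -- At the nodes k has the slope of g, and the slope of gh is at most ψ there, so k - gh satisfies
  -- the nodal condition of `residual_le`.
  have hres : inner ℝ (toL2 G hG) (k - gh) ≤
      T.h * ν * ‖k - gh‖ + 9 * T.h ^ 2 / β * ν ^ 2 := by
    have h1 := hT.residual_le ho he (memL2_coe (k - gh)) fun i hi => by
      have hmem := hT.mem hi.le
      have h2 : ∫ t in T.nodeSeq i..1, (k - gh : L2I) t = slopeAt (T.nodeSeq i) gh -
          slopeAt (T.nodeSeq i) k := by
        rw [← map_sub, slopeAt_eq _ hmem, ← intervalIntegral.integral_neg]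
        refine intervalIntegral_congr_ae_I ?_ hmem one_mem_Ibar
        rw [← neg_sub k gh]
        filter_upwards [Lp.coeFn_neg (k - gh)] with t ht
        rw [ht, Pi.neg_apply, neg_neg]
      have h3 : slopeAt (T.nodeSeq i) k = slopeAt (T.nodeSeq i) g := by
        rw [slopeAt_eq _ hmem, slopeAt_eq _ hmem,
          intervalIntegral_congr_ae_I (coe_toL2 _) hmem one_mem_Ibar,
          hT.integral_stepMean_tail (memL2_coe g).intervalIntegrable hi.le]
      rw [h2, h3]
      have h4 := hgh.2 (T.nodeSeq i) ⟨_, rfl⟩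
      linarith
    rw [← hν, ← norm_toL2_eq (memL2_coe (k - gh)), toL2_coe] at h1
    have h5 : inner ℝ (toL2 G hG) (k - gh) = ∫ t in (-1)..1, G t * (k - gh : L2I) t := by
      rw [← inner_toL2_eq hG (memL2_coe (k - gh)), toL2_coe]
    have h6 : ν ^ 2 = ∫ t in (-1)..1, e t ^ 2 :=
      Real.sq_sqrt (intervalIntegral.integral_nonneg (by norm_num) fun _ _ => sq_nonneg _)
    rw [h5, h6]
    exact h1
  rw [← hgrad] at hres
  set E := ‖gh - g‖ with hE
  set δ := ‖k - g‖ with hδd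
  have hE0 : 0 ≤ E := norm_nonneg _
  have hδ0 : 0 ≤ δ := norm_nonneg _
  have hr : ‖k - gh‖ ≤ δ + E := by
    have : k - gh = (k - g) - (gh - g) := by abel
    rw [this]
    exact norm_sub_le _ _
  -- Writing k - gh = (k - g) - (gh - g) extracts the gradient at g and the negative squared errors
  -- from the discrete variational inequality.
  have hs1 : inner ℝ (stateOp gh - toL2 yd hyd) (stateOp (k - gh)) =
      inner ℝ (stateOp g - toL2 yd hyd) (stateOp (k - gh)) +
        inner ℝ (stateOp (gh - g)) (stateOp (k - g)) - ‖stateOp (gh - g)‖ ^ 2 := by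
    rw [← real_inner_self_eq_norm_sq, add_sub_assoc, ← inner_sub_right, ← map_sub,
      show k - g - (gh - g) = k - gh by abel, ← inner_add_left, map_sub stateOp gh g]
    congr 1
    abel
  have hs2 : inner ℝ (gh + toL2 f hf.1) (k - gh) = inner ℝ (g + toL2 f hf.1) (k - gh) +
      inner ℝ (gh - g) (k - g) - E ^ 2 := by
    rw [hE, ← real_inner_self_eq_norm_sq, add_sub_assoc, ← inner_sub_right,
      show k - g - (gh - g) = k - gh by abel, ← inner_add_left]
    congr 1
    abel
  have hc1 : inner ℝ (stateOp (gh - g)) (stateOp (k - g)) ≤ ‖stateOp (gh - g)‖ * (N * δ) :=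
    (real_inner_le_norm _ _).trans
      (mul_le_mul_of_nonneg_left (stateOp.le_opNorm _) (norm_nonneg _))
  have hc2 : inner ℝ (gh - g) (k - g) ≤ E * δ := real_inner_le_norm _ _
  rw [hs1, hs2] at hvi
  have hNδ : (N * δ) ^ 2 / 4 ≤ N ^ 2 * μ ^ 2 / 4 * T.h ^ 2 := by
    have : (N * δ) ^ 2 ≤ (N * (T.h * μ)) ^ 2 :=
      pow_le_pow_left₀ (by positivity) (mul_le_mul_of_nonneg_left hδ hN0) 2
    linarith
  have hq1 : β * E ^ 2 ≤ (N * δ) ^ 2 / 4 + β * (E * δ) +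
      (T.h * ν * (δ + E) + 9 * T.h ^ 2 / β * ν ^ 2) := by
    have h1 : T.h * ν * ‖k - gh‖ ≤ T.h * ν * (δ + E) :=
      mul_le_mul_of_nonneg_left hr (by positivity)
    have h2 : β * inner ℝ (gh - g) (k - g) ≤ β * (E * δ) := mul_le_mul_of_nonneg_left hc2 hβ.le
    -- Young's inequality absorbs ‖S(gh - g)‖ N δ into ‖S(gh - g)‖² and leaves (N δ)²/4.
    have h3 := sq_nonneg (‖stateOp (gh - g)‖ - N * δ / 2)
    linarith
  have hq2 : β * E ^ 2 ≤ N ^ 2 * μ ^ 2 / 4 * T.h ^ 2 + β * (E * (T.h * μ)) +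
      (T.h * ν * (T.h * μ + E) + 9 * T.h ^ 2 / β * ν ^ 2) := by
    have h1 : β * (E * δ) ≤ β * (E * (T.h * μ)) :=
      mul_le_mul_of_nonneg_left (mul_le_mul_of_nonneg_left hδ hE0) hβ.le
    have h2 : T.h * ν * (δ + E) ≤ T.h * ν * (T.h * μ + E) :=
      mul_le_mul_of_nonneg_left (by linarith) (by positivity)
    linarith
  refine linear_bound_of_quadratic hH (by positivity) (by positivity) ?_
  refine le_of_mul_le_mul_left (hq2.trans (le_of_eq ?_)) hβ
  field_simp
  ring

/-! ### Error norms in terms of the second derivatives -/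

theorem h1SemiDist_le {y z : H2} (hy : InV y) (hz : InV z) :
    h1SemiDist y z ≤ ‖(slopeOp : L2I →L[ℝ] L2I)‖ * ‖z.curv - y.curv‖ := by
  rw [h1SemiDist, l2Norm_eq (y.memL2_d1.sub z.memL2_d1), toL2_sub y.memL2_d1 z.memL2_d1, ← hy.slopeOp_curv,
    ← hz.slopeOp_curv, ← map_sub, norm_sub_rev z.curv]
  exact slopeOp.le_opNorm _

theorem l2Norm_val_sub_le {y z : H2} (hy : InV y) (hz : InV z) :
    l2Norm (fun x => y.val x - z.val x) ≤
      ‖(stateOp : L2I →L[ℝ] L2I)‖ * ‖z.curv - y.curv‖ := by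
  rw [l2Norm_eq (y.memL2_val.sub z.memL2_val), toL2_sub y.memL2_val z.memL2_val, ← hy.stateOp_curv,
    ← hz.stateOp_curv, ← map_sub, norm_sub_rev z.curv]
  exact stateOp.le_opNorm _

theorem l2Norm_d2_sub (y z : H2) : l2Norm (fun x => y.d2 x - z.d2 x) = ‖z.curv - y.curv‖ := by
  rw [l2Norm_eq (y.d2_mem.sub z.d2_mem), toL2_sub y.d2_mem z.d2_mem, norm_sub_rev]
  rfl

theorem l2Norm_nonneg (w : ℝ → ℝ) : 0 ≤ l2Norm w := Real.sqrt_nonneg _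

theorem h2Dist_le {y z : H2} (hy : InV y) (hz : InV z) :
    h2Dist y z ≤ (‖(stateOp : L2I →L[ℝ] L2I)‖ + ‖(slopeOp : L2I →L[ℝ] L2I)‖ + 1) *
      ‖z.curv - y.curv‖ := by
  have h1 := l2Norm_val_sub_le hy hz
  have h2 : l2Norm (fun x => y.d1 x - z.d1 x) ≤ _ := h1SemiDist_le hy hz
  have h3 := (l2Norm_d2_sub y z).le
  have p1 := l2Norm_nonneg fun x => y.val x - z.val x
  have p2 := l2Norm_nonneg fun x => y.d1 x - z.d1 x
  have p3 := l2Norm_nonneg fun x => y.d2 x - z.d2 x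
  have h4 : h2Dist y z ≤ l2Norm (fun x => y.val x - z.val x) +
      l2Norm (fun x => y.d1 x - z.d1 x) + l2Norm (fun x => y.d2 x - z.d2 x) := by
    rw [h2Dist, Real.sqrt_le_left (by positivity)]
    nlinarith [mul_nonneg p1 p2, mul_nonneg p1 p3, mul_nonneg p2 p3]
  linarith

theorem l2Norm_control_sub {f u : ℝ → ℝ} {y z : H2}
    (hu : u =ᵐ[volume.restrict I] control f y) :
    l2Norm (fun x => u x - control f z x) = ‖z.curv - y.curv‖ := by
  rw [← l2Norm_d2_sub, l2Norm, l2Norm]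
  congr 1
  refine integral_congr_ae ?_
  filter_upwards [hu] with x hx
  rw [hx, control, control]
  ring

theorem eqOn_val_of_curv_eq {y z : H2} (hy : InV y) (hz : InV z) (h : z.curv = y.curv) :
    EqOn z.val y.val Ibar := fun x hx => by
  rw [hz.val_eq hx, hy.val_eq hx, h]

theorem control_ae_eq_of_curv_eq (f : ℝ → ℝ) {y z : H2} (h : z.curv = y.curv) :
    control f z =ᵐ[volume.restrict I] control f y := by
  filter_upwards [coe_toL2 z.d2_mem, coe_toL2 y.d2_mem] with x h1 h2
  have h3 : (z.curv : ℝ → ℝ) x = z.d2 x := h1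
  have h4 : (y.curv : ℝ → ℝ) x = y.d2 x := h2
  rw [control, control, ← h3, ← h4, h]

end DerivOCP

/-- For the mixed boundary conditions `y(-1) = y'(1) = 0` the optimal control problem and its cubic
Hermite discretizations are uniquely solvable, and the errors are `O(h)` with a constant that does
not depend on the mesh within a quasi-uniform family. -/
theorem theorem3p2 (β : ℝ) (hβ : 0 < β)
    (yd : ℝ → ℝ) (hyd : DerivOCP.MemL2 yd)
    (f : ℝ → ℝ) (hf : DerivOCP.MemH1 f)
    (ψ : DerivOCP.H2) (hψ : 0 ≤ ψ.val 1) :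
    (∃ (y : DerivOCP.H2) (u : ℝ → ℝ), DerivOCP.IsOptimal β yd f ψ y u ∧
      ∀ (z : DerivOCP.H2) (w : ℝ → ℝ), DerivOCP.IsOptimal β yd f ψ z w →
        EqOn z.val y.val DerivOCP.Ibar ∧ w =ᵐ[volume.restrict DerivOCP.I] u) ∧
    (∀ T : DerivOCP.Mesh, ∃ yh : DerivOCP.H2, DerivOCP.IsDiscreteOptimal T β yd f ψ yh ∧
      ∀ zh : DerivOCP.H2, DerivOCP.IsDiscreteOptimal T β yd f ψ zh →
        EqOn zh.val yh.val DerivOCP.Ibar) ∧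
    ∀ (y : DerivOCP.H2) (u : ℝ → ℝ), DerivOCP.IsOptimal β yd f ψ y u →
      ∀ κ : ℝ, ∃ C : ℝ, 0 < C ∧
        ∀ T : DerivOCP.Mesh, T.QuasiUniform κ →
          ∀ yh : DerivOCP.H2, DerivOCP.IsDiscreteOptimal T β yd f ψ yh →
            DerivOCP.h1SemiDist y yh
                + DerivOCP.l2Norm (fun x => u x - DerivOCP.control f yh x) ≤ C * T.h ∧
            DerivOCP.h2Dist y yh ≤ C * T.h := by
  open DerivOCP in
  obtain ⟨k, hkK, hkT⟩ := exists_feasible hψ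
  refine ⟨?_, fun T => ?_, fun y u hyu κ => ?_⟩
  · obtain ⟨g, hg, hmin⟩ := exists_cost_minimizer hβ stateOp (toL2 yd hyd) (toL2 f hf.1) ⟨k, hkK⟩
      (isClosed_slopeBelow _ _) (convex_slopeBelow _ _)
    refine ⟨ofL2 g, control f (ofL2 g), (isOptimal_iff hyd hf.1).2 ⟨inV_ofL2 g,
      Filter.EventuallyEq.rfl, by rwa [curv_ofL2], by rwa [curv_ofL2]⟩, fun z w hzw => ?_⟩
    obtain ⟨hz, hw, hzK, hzmin⟩ := (isOptimal_iff hyd hf.1).1 hzw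
    have he : z.curv = (ofL2 g).curv := by
      rw [curv_ofL2]
      exact cost_minimizer_unique hβ stateOp (convex_slopeBelow _ _) hg hmin hzK hzmin
    exact ⟨eqOn_val_of_curv_eq (inV_ofL2 g) hz he, hw.trans (control_ae_eq_of_curv_eq f he)⟩
  · obtain ⟨g, hg, hmin⟩ := exists_cost_minimizer hβ stateOp (toL2 yd hyd) (toL2 f hf.1)
      ⟨k, hkT T⟩ (isClosed_discreteSet T ψ.val) (convex_discreteSet T ψ.val)
    refine ⟨ofL2 g, (isDiscreteOptimal_iff hyd hf.1 hψ).2 ⟨inV_ofL2 g, by rwa [curv_ofL2],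
      by rwa [curv_ofL2]⟩, fun z hz => ?_⟩
    obtain ⟨hzV, hzK, hzmin⟩ := (isDiscreteOptimal_iff hyd hf.1 hψ).1 hz
    refine eqOn_val_of_curv_eq (inV_ofL2 g) hzV ?_
    rw [curv_ofL2]
    exact cost_minimizer_unique hβ stateOp (convex_discreteSet T ψ.val) hg hmin hzK hzmin
  · obtain ⟨hy, hu, hyK, hymin⟩ := (isOptimal_iff hyd hf.1).1 hyu
    obtain ⟨C, hC, hbound⟩ := exists_error_bound hβ hyd hf hyK hymin
    set N := ‖(stateOp : L2I →L[ℝ] L2I)‖ + ‖(slopeOp : L2I →L[ℝ] L2I)‖ + 1 with hN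
    have hS := norm_nonneg (stateOp : L2I →L[ℝ] L2I)
    have hD := norm_nonneg (slopeOp : L2I →L[ℝ] L2I)
    have hN0 : 0 ≤ N := by positivity
    -- The summand 1 ensures strict positivity, since C is only known to be nonnegative.
    refine ⟨N * C + 1, by positivity, fun T _ yh hyh => ?_⟩
    obtain ⟨hyhV, hyhK, hyhmin⟩ := (isDiscreteOptimal_iff hyd hf.1 hψ).1 hyh
    have hE := hbound T yh.curv hyhK hyhmin
    have hH := T.isNodes.H_pos
    have hE0 := norm_nonneg (yh.curv - y.curv)
    have hNE : N * ‖yh.curv - y.curv‖ ≤ (N * C + 1) * T.h := by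
      have := mul_le_mul_of_nonneg_left hE hN0
      linarith
    constructor
    · rw [l2Norm_control_sub hu]
      have h1 := h1SemiDist_le hy hyhV
      have h2 := mul_nonneg hS hE0
      linarith
    · exact (h2Dist_le hy hyhV).trans hNE
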